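/- Let $k$ be a field. \textbf{Brauer configurations.} A Brauer configuration is a tuple $\Delta=(\Delta_0,\Delta_1,\zeta,P,\mathfrak p,\nu)$ with finite sets $\Delta_0$ (vertices) and $\Delta_1$ (angles), a surjection $\zeta:\Delta_1\to\Delta_0$, a partition $P$ of $\Delta_1$ all of whose classes $P(e)$ (polygons) have at least two elements, a permutation $\mathfrak p$ of $\Delta_1$ whose cycles are the sets $\zeta^{-1}(\alpha)$, $\alpha\in\Delta_0$, and a function $\nu:\Delta_0\to\mathbb Z_{>0}$, such that every polygon contains an angle $h$ with $|\zeta^{-1}(\zeta(h))|\cdot\nu(\zeta(h))>1$. Its quiver $Q_\Delta$ has the polygons as vertices and one arrow $e:P(e)\to P(\mathfrak p(e))$ for each angle $e$. Writing paths from right to left, put $p(e)=\mathfrak p^{n-1}(e)\cdots\mathfrak p(e)\,e$, where $n\ge 1$ is minimal with $\mathfrak p^n(e)=e$. The Brauer configuration algebra of $\Delta$ is $kQ_\Delta/I_\Delta$, where $I_\Delta$ is the ideal generated by the elements $p(e)^{\nu(\zeta(e))}-p(h)^{\nu(\zeta(h))}$ with $P(e)=P(h)$ and $e_2e_1$ with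 $e_2\ne\mathfrak p(e_1)$. An algebra is called a Brauer configuration algebra if it is isomorphic to one of this form. \textbf{Fractional Brauer configurations.} Let $\langle g\rangle$ be an infinite cyclic group. A fractional Brauer configuration $E=(E,P,L,d)$ is a $\langle g\rangle$-set $E$ with two partitions $P,L$ (with classes $P(e)$, $L(e)$) and a function $d:E\to\mathbb Z_{>0}$ such that for all $e,h\in E$: (f1) $L(e)\subseteq P(e)$ and $P(e)$ is finite; (f2) $L(e)=L(h)$ implies $P(g\cdot e)=P(g\cdot h)$; (f3) $d$ is constant on $\langle g\rangle$-orbits; (f4) $P(e)=P(h)$ if and only if $P(g^{d(e)}\cdot e)=P(g^{d(h)}\cdot h)$; (f5) $L(e)=L(h)$ if and only if $L(g^{d(e)}\cdot e)=L(g^{d(h)}\cdot h)$; (f6) the formal sequence $L(g^{d(e)-1}\cdot e)\cdots L(g\cdot e)L(e)$ is not a proper contiguous subsequence of $L(g^{d(h)-1}\cdot h)\cdots L(g\cdot h)L(h)$. It is finite if $E$ is a finite set, of type MS if $L(e)=\{e\}$ for all $e$, and has integral f-degree if every $\langle g\rangle$-orbit $v$ is finite and $d(e)/|v|$ is an integer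 for $e\in v$. The quiver $Q_E$ has vertices $P(e)$ and arrows $L(e):P(e)\to P(g\cdot e)$, $e\in E$ (one arrow for each class of $L$). Let $I_E$ be the ideal of the path category $kQ_E$ generated by (fR1) $L(g^{d(e)-1-m}\cdot e)\cdots L(e)-L(g^{d(h)-1-m}\cdot h)\cdots L(h)$, where $P(e)=P(h)$, $0\le m\le\min(d(e),d(h))$ and $L(g^{d(e)-i}\cdot e)=L(g^{d(h)-i}\cdot h)$ for $1\le i\le m$; (fR2) paths $L(e_n)\cdots L(e_1)$, $n>1$, with $\bigcap_{i=1}^n g^{n-i}\cdot L(e_i)=\emptyset$; (fR3) paths $L(g^{n-1}\cdot e)\cdots L(e)$ with $n>d(e)$. Put $\Lambda_E=kQ_E/I_E$ and, for finite $E$, $A_E=\bigl(\bigoplus_{x,y}\Lambda_E(x,y)\bigr)^{op}$. \textbf{Statement.} Assume that $k$ is algebraically closed. If $E$ is a finite fractional Brauer configuration of type MS with integral f-degree such that every polygon $P(e)$ contains an angle $h$ with $d(h)>1$, then $A_E$ is a Brauer configuration algebra. Conversely, every Brauer configuration algebra is isomorphic, as a $k$-algebra, to $A_E$ for some finite fractional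 Brauer configuration $E$ of type MS with integral f-degree in which every polygon contains an angle $h$ with $d(h)>1$. -/

import Mathlib

universe u v

open CategoryTheory

noncomputable section

namespace FracBrauer

/-! ### Linear categories: ideals, quotients, and the algebra of a category with finitely many objects -/

section LinearCategory

variable {k : Type*} [Field k] {C : Type*} [Category C] [Preadditive C] [Linear k C]

/-- The `(X, Y)`-component of the ideal of the `k`-linear category `C` generated by a family `S`
of sets of morphisms: the `k`-span of all composites `a ≫ r ≫ b` with `r` in `S`. -/
def idealSpan (k : Type*) [Field k] {C : Type*} [Category C] [Preadditive C] [Linear k C]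
    (S : (X Y : C) → Set (X ⟶ Y)) (X Y : C) : Submodule k (X ⟶ Y) :=
  Submodule.span k {f | ∃ (X' Y' : C) (a : X ⟶ X') (r : X' ⟶ Y') (b : Y' ⟶ Y),
    r ∈ S X' Y' ∧ f = a ≫ r ≫ b}

theorem idealSpan_precomp (S : (X Y : C) → Set (X ⟶ Y)) {X Y Z : C} (a : X ⟶ Y) {f : Y ⟶ Z}
    (hf : f ∈ idealSpan k S Y Z) : a ≫ f ∈ idealSpan k S X Z := by
  unfold idealSpan at hf ⊢
  induction hf using Submodule.span_induction with
  | mem f hf =>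
    obtain ⟨X', Y', a', r, b, hr, rfl⟩ := hf
    exact Submodule.subset_span ⟨X', Y', a ≫ a', r, b, hr, by simp⟩
  | zero => simp
  | add f g _ _ hf hg => rw [Preadditive.comp_add]; exact Submodule.add_mem _ hf hg
  | smul c f _ hf => rw [Linear.comp_smul]; exact Submodule.smul_mem _ c hf

theorem idealSpan_postcomp (S : (X Y : C) → Set (X ⟶ Y)) {X Y Z : C} {f : X ⟶ Y} (b : Y ⟶ Z)
    (hf : f ∈ idealSpan k S X Y) : f ≫ b ∈ idealSpan k S X Z := by
  unfold idealSpan at hf ⊢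
  induction hf using Submodule.span_induction with
  | mem f hf =>
    obtain ⟨X', Y', a, r, b', hr, rfl⟩ := hf
    exact Submodule.subset_span ⟨X', Y', a, r, b' ≫ b, hr, by simp⟩
  | zero => simp
  | add f g _ _ hf hg => rw [Preadditive.add_comp]; exact Submodule.add_mem _ hf hg
  | smul c f _ hf => rw [Linear.smul_comp]; exact Submodule.smul_mem _ c hf

/-- Congruence of morphisms modulo the ideal generated by `S`. -/
def idealRel (k : Type*) [Field k] {C : Type*} [Category C] [Preadditive C] [Linear k C]
    (S : (X Y : C) → Set (X ⟶ Y)) : HomRel C :=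
  fun X Y f g => f - g ∈ idealSpan k S X Y

instance idealRel_congruence (S : (X Y : C) → Set (X ⟶ Y)) : Congruence (idealRel k S) where
  equivalence :=
    { refl := fun f => by simp [idealRel]
      symm := fun {f g} h => by
        have := Submodule.neg_mem _ h
        rwa [neg_sub] at this
      trans := fun {f g h} h₁ h₂ => by
        have := Submodule.add_mem _ h₁ h₂
        rwa [sub_add_sub_cancel] at this }
  comp_left := by
    intro X Y Z f g g' h
    have := idealSpan_precomp S f h
    rwa [Preadditive.comp_sub] at this
  comp_right := by
    intro X Y Z f f' g h
    have := idealSpan_postcomp S g h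
    rwa [Preadditive.sub_comp] at this

theorem idealRel_add (S : (X Y : C) → Set (X ⟶ Y)) ⦃X Y : C⦄ (f₁ f₂ g₁ g₂ : X ⟶ Y)
    (h : idealRel k S f₁ f₂) (h' : idealRel k S g₁ g₂) :
    idealRel k S (f₁ + g₁) (f₂ + g₂) := by
  have := Submodule.add_mem _ h h'
  rwa [sub_add_sub_comm] at this

theorem idealRel_smul (S : (X Y : C) → Set (X ⟶ Y)) (c : k) ⦃X Y : C⦄ (f₁ f₂ : X ⟶ Y)
    (h : idealRel k S f₁ f₂) : idealRel k S (c • f₁) (c • f₂) := by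
  have := Submodule.smul_mem _ c h
  rwa [smul_sub] at this

/-- The quotient of the `k`-linear category `C` by the ideal generated by `S`. -/
abbrev QuotCat (k : Type*) [Field k] {C : Type*} [Category C] [Preadditive C] [Linear k C]
    (S : (X Y : C) → Set (X ⟶ Y)) : Type _ :=
  CategoryTheory.Quotient (idealRel k S)

instance quotCatPreadditive (S : (X Y : C) → Set (X ⟶ Y)) : Preadditive (QuotCat k S) :=
  CategoryTheory.Quotient.preadditive _ (idealRel_add S)

instance quotCatFunctorAdditive (S : (X Y : C) → Set (X ⟶ Y)) :
    (CategoryTheory.Quotient.functor (idealRel k S)).Additive :=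
  CategoryTheory.Quotient.functor_additive _ (idealRel_add S)

instance quotCatLinear (S : (X Y : C) → Set (X ⟶ Y)) : Linear k (QuotCat k S) :=
  CategoryTheory.Quotient.linear k _ (idealRel_smul S)

end LinearCategory

section CatAlg

/-- The space `⨁ x y, C(x, y)` for a category `C` with finitely many objects. -/
def CatAlg (C : Type*) [Category C] : Type _ := (x y : C) → (x ⟶ y)

variable {C : Type*} [Category C]

theorem CatAlg.ext {a b : CatAlg C} (h : ∀ x z, a x z = b x z) : a = b :=
  funext fun x => funext fun z => h x z

variable [Preadditive C]

instance : AddCommGroup (CatAlg C) := inferInstanceAs (AddCommGroup ((x y : C) → (x ⟶ y)))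

/-- The element of `⨁ x y, C(x, y)` given by one morphism. -/
def CatAlg.of {x y : C} (f : x ⟶ y) : CatAlg C := by
  classical exact Pi.single x (Pi.single y f)

/-- The multiplication of `⨁ x y, C(x, y)` is the composition of morphisms, from right to left:
the product of `a : y ⟶ z` and `b : x ⟶ y` is `a ∘ b = b ≫ a`, and products of morphisms that
cannot be composed are zero. -/
instance [Fintype C] : Mul (CatAlg C) := ⟨fun a b x z => ∑ y : C, b x y ≫ a y z⟩

instance : One (CatAlg C) := ⟨by classical exact fun x => Pi.single x (𝟙 x)⟩

theorem CatAlg.mul_apply [Fintype C] (a b : CatAlg C) (x z : C) :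
    (a * b) x z = ∑ y : C, b x y ≫ a y z := rfl

theorem CatAlg.add_apply (a b : CatAlg C) (x z : C) : (a + b) x z = a x z + b x z := rfl

theorem CatAlg.zero_apply (x z : C) : (0 : CatAlg C) x z = 0 := rfl

theorem CatAlg.one_apply_self (x : C) : (1 : CatAlg C) x x = 𝟙 x := by
  classical
  change (Pi.single x (𝟙 x) : (y : C) → (x ⟶ y)) x = 𝟙 x
  simp

theorem CatAlg.one_apply_ne {x y : C} (h : y ≠ x) : (1 : CatAlg C) x y = 0 := by
  classical
  change (Pi.single x (𝟙 x) : (y : C) → (x ⟶ y)) y = 0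
  simp [h]

instance [Fintype C] : Ring (CatAlg C) :=
  { (inferInstance : AddCommGroup (CatAlg C)), (inferInstance : Mul (CatAlg C)),
    (inferInstance : One (CatAlg C)) with
    left_distrib := fun a b c => CatAlg.ext fun x z => by
      simp [CatAlg.mul_apply, CatAlg.add_apply, Finset.sum_add_distrib]
    right_distrib := fun a b c => CatAlg.ext fun x z => by
      simp [CatAlg.mul_apply, CatAlg.add_apply, Finset.sum_add_distrib]
    zero_mul := fun a => CatAlg.ext fun x z => by
      simp [CatAlg.mul_apply, CatAlg.zero_apply]
    mul_zero := fun a => CatAlg.ext fun x z => by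
      simp [CatAlg.mul_apply, CatAlg.zero_apply]
    mul_assoc := fun a b c => CatAlg.ext fun x z => by
      simp only [CatAlg.mul_apply, Preadditive.sum_comp, Preadditive.comp_sum, Category.assoc]
      exact Finset.sum_comm
    one_mul := fun a => CatAlg.ext fun x z => by
      rw [CatAlg.mul_apply, Finset.sum_eq_single z, CatAlg.one_apply_self, Category.comp_id]
      · intro y _ hy
        rw [CatAlg.one_apply_ne hy.symm, Limits.comp_zero]
      · simp
    mul_one := fun a => CatAlg.ext fun x z => by
      rw [CatAlg.mul_apply, Finset.sum_eq_single x, CatAlg.one_apply_self, Category.id_comp]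
      · intro y _ hy
        rw [CatAlg.one_apply_ne hy, Limits.zero_comp]
      · simp }

instance {k : Type*} [Field k] [Linear k C] : Module k (CatAlg C) :=
  inferInstanceAs (Module k ((x y : C) → (x ⟶ y)))

theorem CatAlg.smul_apply {k : Type*} [Field k] [Linear k C] (c : k) (a : CatAlg C) (x z : C) :
    (c • a) x z = c • a x z := rfl

instance {k : Type*} [Field k] [Linear k C] [Fintype C] : Algebra k (CatAlg C) :=
  Algebra.ofModule
    (fun c a b => CatAlg.ext fun x z => by
      simp [CatAlg.mul_apply, CatAlg.smul_apply, Finset.smul_sum])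
    (fun c a b => CatAlg.ext fun x z => by
      simp [CatAlg.mul_apply, CatAlg.smul_apply, Finset.smul_sum])

end CatAlg

/-! ### Path categories and path algebras of quivers -/

/-- The path category `kQ`: objects are the vertices of `Q`, and the morphisms from `x` to `y` are
the formal `k`-linear combinations of the paths from `x` to `y`. -/
abbrev PathCat (k : Type*) [Field k] (Q : Type*) [Quiver Q] : Type _ := Free k (Paths Q)

/-- A vertex, as an object of the path category. -/
def pathObj (k : Type*) [Field k] {Q : Type*} [Quiver Q] (x : Q) : PathCat k Q := x

/-- A path, as a morphism of the path category. -/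
def pathHom (k : Type*) [Field k] {Q : Type*} [Quiver Q] {x y : Q} (p : Quiver.Path x y) :
    pathObj k x ⟶ pathObj k y :=
  (Free.embedding k (Paths Q)).map (X := x) (Y := y) p

instance pathCatFintype (k : Type*) [Field k] (Q : Type*) [Quiver Q] [Finite Q] :
    Fintype (PathCat k Q) := @Fintype.ofFinite Q _

/-- The path algebra of a quiver with finitely many vertices; paths are multiplied from right to
left, that is, `p * q` is the path `q` followed by the path `p`. -/
abbrev PathAlg (k : Type*) [Field k] (Q : Type*) [Quiver Q] : Type _ := CatAlg (PathCat k Q)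

/-! ### Brauer configurations and Brauer configuration algebras -/

/-- A Brauer configuration with finite set of vertices `V` and finite set of angles `A`. -/
structure BrauerConfig (V A : Type*) [Finite V] [Finite A] where
  /-- The connection map. -/
  conn : A → V
  conn_surjective : Function.Surjective conn
  /-- The partition into polygons. -/
  P : Setoid A
  two_le_polygon : ∀ e : A, 2 ≤ {h : A | P e h}.ncard
  /-- The orientation. -/
  next : Equiv.Perm A
  conn_eq_iff : ∀ e h : A, conn e = conn h ↔ next.SameCycle e h
  /-- The multiplicity function. -/
  mult : V → ℕ
  mult_pos : ∀ v, 0 < mult v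
  exists_not_truncated : ∀ e : A, ∃ h : A, P e h ∧
    1 < {a : A | conn a = conn h}.ncard * mult (conn h)

namespace BrauerConfig

variable {V A : Type*} [Finite V] [Finite A] (D : BrauerConfig V A)

/-- The vertex set of the quiver of a Brauer configuration: the set of polygons. -/
def Polygon : Type _ := Quotient D.P

/-- The polygon of an angle. -/
def polygon (e : A) : D.Polygon := Quotient.mk D.P e

instance : Finite D.Polygon := inferInstanceAs (Finite (Quotient D.P))

/-- The quiver of a Brauer configuration: each angle `e` is an arrow from the polygon of `e` to
the polygon of the successor of `e`. -/
instance quiver : Quiver D.Polygon where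
  Hom x y := {e : A // D.polygon e = x ∧ D.polygon (D.next e) = y}

/-- The angle `e`, as an arrow. -/
def arrow (e : A) : D.polygon e ⟶ D.polygon (D.next e) := ⟨e, rfl, rfl⟩

/-- The angle `e`, as an element of the path algebra. -/
def arrowElt (k : Type*) [Field k] (e : A) : PathAlg k D.Polygon :=
  CatAlg.of (pathHom k (D.arrow e).toPath)

/-- The cycle `next^(n-1)(e) ⋯ next(e) e` in the path algebra, where `n` is the smallest positive
integer with `next^n(e) = e`. -/
def specialCycle (k : Type*) [Field k] (e : A) : PathAlg k D.Polygon :=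
  ((List.range (Function.minimalPeriod D.next e)).map
    (fun i => D.arrowElt k ((D.next ^ i) e))).reverse.prod

/-- The relations of the Brauer configuration algebra: pairs of elements to be identified. -/
inductive Rel (k : Type*) [Field k] : PathAlg k D.Polygon → PathAlg k D.Polygon → Prop
  | cycle (e h : A) : D.P e h →
      Rel k (D.specialCycle k e ^ D.mult (D.conn e)) (D.specialCycle k h ^ D.mult (D.conn h))
  | zero (e₁ e₂ : A) : e₂ ≠ D.next e₁ → Rel k (D.arrowElt k e₂ * D.arrowElt k e₁) 0

/-- The Brauer configuration algebra: the quotient of the path algebra by the two-sided ideal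
generated by the relations. -/
abbrev algebra (k : Type*) [Field k] : Type _ := RingQuot (D.Rel k)

end BrauerConfig

/-! ### Fractional Brauer configurations -/

/-- A fractional Brauer configuration on a set `E` of angles. The action of the infinite cyclic
group `⟨g⟩` on `E` is given by the permutation `g`, whose integer powers are the action of the
group, and the two partitions by equivalence relations `P`, `L`. -/
structure FracBrauerConfig (E : Type*) where
  g : Equiv.Perm E
  P : Setoid E
  L : Setoid E
  d : E → ℕ
  d_pos : ∀ e, 0 < d e
  f1_le : ∀ e h, L e h → P e h
  f1_finite : ∀ e, {h | P e h}.Finite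
  f2 : ∀ e₁ e₂, L e₁ e₂ → P (g e₁) (g e₂)
  f3 : ∀ e₁ e₂, g.SameCycle e₁ e₂ → d e₁ = d e₂
  f4 : ∀ e₁ e₂, P e₁ e₂ ↔ P ((g ^ d e₁) e₁) ((g ^ d e₂) e₂)
  f5 : ∀ e₁ e₂, L e₁ e₂ ↔ L ((g ^ d e₁) e₁) ((g ^ d e₂) e₂)
  /-- The formal sequence of `L`-classes of `e, g e, …, g ^ (d e - 1) e` is never a proper
  (contiguous) subsequence of that of another angle. -/
  f6 : ∀ e h,
    ((List.range (d e)).map fun i => (Quotient.mk L ((g ^ i) e))) <:+: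
      ((List.range (d h)).map fun i => (Quotient.mk L ((g ^ i) h))) →
    ((List.range (d e)).map fun i => (Quotient.mk L ((g ^ i) e))) =
      ((List.range (d h)).map fun i => (Quotient.mk L ((g ^ i) h)))

namespace FracBrauerConfig

variable {E : Type*} (B : FracBrauerConfig E)

/-- Type MS: the partition `L` is trivial. -/
def IsTypeMS : Prop := ∀ e h, B.L e h → e = h

/-- The vertex (that is, the `⟨g⟩`-orbit) of the angle `e`. -/
def vertex (e : E) : Set E := {h | B.g.SameCycle e h}

/-- The fractional degree of the vertex of `e`, meaningful if that vertex is a finite set. -/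
def fDegree (e : E) : ℚ := (B.d e : ℚ) / ((B.vertex e).ncard : ℚ)

/-- All vertices are finite sets and have an integer as fractional degree. -/
def HasIntegralFDegree : Prop :=
  ∀ e, (B.vertex e).Finite ∧ ∃ m : ℤ, B.fDegree e = m

/-- The vertex set of the quiver: the set of polygons, that is, of classes of `P`. -/
def Polygon : Type _ := Quotient B.P

/-- The polygon of an angle. -/
def polygon (e : E) : B.Polygon := Quotient.mk B.P e

instance [Finite E] : Finite B.Polygon := inferInstanceAs (Finite (Quotient B.P))

/-- The source `P(e)` of the class `L(e)`. -/
def src : Quotient B.L → B.Polygon :=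
  Quotient.lift B.polygon fun e h hl => Quotient.sound (B.f1_le e h hl)

/-- The terminal `P(g e)` of the class `L(e)`. -/
def tgt : Quotient B.L → B.Polygon :=
  Quotient.lift (fun e => B.polygon (B.g e)) fun e h hl => Quotient.sound (B.f2 e h hl)

/-- The quiver of a fractional Brauer configuration: the arrows are the classes of `L`. -/
instance quiver : Quiver B.Polygon where
  Hom x y := {l : Quotient B.L // B.src l = x ∧ B.tgt l = y}

/-- The list of arrows of a path, from its source to its target. -/
def arrows {x : B.Polygon} : {y : B.Polygon} → Quiver.Path x y → List (Quotient B.L)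
  | _, Quiver.Path.nil => []
  | _, Quiver.Path.cons p a => arrows p ++ [a.1]

/-- The list `L(e), L(g e), …, L(g ^ (n - 1) e)`. -/
def stdList (e : E) (n : ℕ) : List (Quotient B.L) :=
  (List.range n).map fun i => Quotient.mk B.L ((B.g ^ i) e)

/-- The relations generating the ideal of the path category. -/
inductive IsRel (k : Type*) [Field k] : (x y : PathCat k B.Polygon) → (x ⟶ y) → Prop
  /-- Differences of two parallel paths `L(g^(d(e)-1-m) e) ⋯ L(e)` and `L(g^(d(h)-1-m) h) ⋯ L(h)`
  where the last `m` terms that are missing agree. -/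
  | fR1 (e h : E) (m : ℕ) (x y : B.Polygon) (p q : Quiver.Path x y) :
      B.polygon e = x → B.polygon h = x → m ≤ B.d e → m ≤ B.d h →
      (∀ i, 1 ≤ i → i ≤ m → B.L ((B.g ^ (B.d e - i)) e) ((B.g ^ (B.d h - i)) h)) →
      B.arrows p = B.stdList e (B.d e - m) → B.arrows q = B.stdList h (B.d h - m) →
      IsRel k (pathObj k x) (pathObj k y) (pathHom k p - pathHom k q)
  /-- Paths `L(e_{n-1}) ⋯ L(e_0)`, `n > 1`, where the sets `g^(n-1-i) L(e_i)` have no common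
  element. -/
  | fR2 (n : ℕ) (e : Fin n → E) (x y : B.Polygon) (p : Quiver.Path x y) :
      1 < n → B.arrows p = List.ofFn (fun i => Quotient.mk B.L (e i)) →
      (⋂ i : Fin n, (B.g ^ (n - 1 - (i : ℕ))) '' {a | B.L (e i) a}) = ∅ →
      IsRel k (pathObj k x) (pathObj k y) (pathHom k p)
  /-- Paths `L(g^(n-1) e) ⋯ L(e)` with `n > d(e)`. -/
  | fR3 (e : E) (n : ℕ) (x y : B.Polygon) (p : Quiver.Path x y) :
      B.d e < n → B.arrows p = B.stdList e n →
      IsRel k (pathObj k x) (pathObj k y) (pathHom k p)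

/-- The fractional Brauer configuration category: the quotient of the path category by the ideal
generated by the relations. -/
abbrev category (k : Type*) [Field k] : Type _ :=
  QuotCat k (C := PathCat k B.Polygon) (fun x y => {f | B.IsRel k x y f})

instance categoryFintype (k : Type*) [Field k] [Finite E] : Fintype (B.category k) :=
  @Fintype.ofInjective _ _ (pathCatFintype k B.Polygon)
    (fun X => X.as) (fun X Y h => by cases X; cases Y; cases h; rfl)

/-- The fractional Brauer configuration algebra of a finite fractional Brauer configuration: the
opposite algebra of the direct sum of all morphism spaces of its category. -/
abbrev algebra (k : Type*) [Field k] : Type _ := (CatAlg (B.category k))ᵐᵒᵖ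

end FracBrauerConfig

end FracBrauer

end

/-! Passing to the opposite algebra turns the arrow `L(e) : P(e) → P(g e)` into an arrow `P(g e) →
P(e)`, which is the arrow of the angle `g e` in a Brauer configuration with orientation `g⁻¹`. The
isomorphism matches these arrows and matches polygons with polygons.

In type MS with integral f-degree, `g ^ d e` fixes `e`, and the relations shrink to three families.
(fR1) with `m > 0` forces `e = h`, so only the equality of full cycles at a polygon is left. (fR2)
kills the paths that do not follow a `g`-orbit, which amounts to products of two arrows. (fR3) kills
words of length `d e + 1`. The first two families are those of a Brauer configuration algebra. There
the third is a consequence: a polygon has a second angle `h`, the full cycle at `e` equals that at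
`h`, and the latter is annihilated by the arrow `e` (`BrauerConfig.word_angleElt_long`).

The one discrepancy is that a fractional configuration may have polygons with a single angle. Such a
polygon receives an extra angle, fixed by the orientation and of multiplicity one. Its loop is
identified with the full cycle at the polygon, so it adds nothing to the algebra; the zero relations
for the loop hold because (fR3) makes full cycles vanish when multiplied by any arrow on either
side. In the converse direction no angle has to be added.

Both directions are instances of `Comparison`. Maps out of both algebras come from realizations of
their quivers, with relations checked in `linear_eq_zero_of_isRel` and `pathAlgHom_eq_of_rel`, and
the two maps are mutually inverse because they are so on vertices and arrows
(`Comparison.algEquiv`). -/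

noncomputable section

namespace FracBrauer

/-! ### Single-morphism elements and homomorphisms out of the algebra of a category -/

namespace CatAlg

section Of

variable {C : Type*} [Category C] [Preadditive C]

theorem of_apply_self {x y : C} (f : x ⟶ y) : of f x y = f := by
  classical
  change (Pi.single x (Pi.single y f) : (x y : C) → (x ⟶ y)) x y = f
  simp

theorem of_apply_source_ne {x y x' : C} (f : x ⟶ y) (h : x' ≠ x) (z : C) : of f x' z = 0 := by
  classical
  change (Pi.single x (Pi.single y f) : (x y : C) → (x ⟶ y)) x' z = 0
  simp [h]

theorem of_apply_target_ne {x y y' : C} (f : x ⟶ y) (h : y' ≠ y) (z : C) : of f z y' = 0 := by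
  classical
  by_cases hz : z = x
  · subst hz
    change (Pi.single z (Pi.single y f) : (x y : C) → (x ⟶ y)) z y' = 0
    simp [h]
  · exact of_apply_source_ne f hz y'

theorem of_add {x y : C} (f g : x ⟶ y) : of (f + g) = of f + of g := by
  refine CatAlg.ext fun x' y' => ?_
  rw [add_apply]
  by_cases hx : x' = x
  · subst hx
    by_cases hy : y' = y
    · subst hy
      simp only [of_apply_self]
    · simp only [of_apply_target_ne _ hy, add_zero]
  · simp only [of_apply_source_ne _ hx, add_zero]

theorem of_zero (x y : C) : of (0 : x ⟶ y) = 0 := by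
  have h := of_add (0 : x ⟶ y) 0
  simpa using h

theorem of_smul {k : Type*} [Field k] [Linear k C] {x y : C} (c : k) (f : x ⟶ y) :
    of (c • f) = c • of f := by
  refine CatAlg.ext fun x' y' => ?_
  rw [smul_apply]
  by_cases hx : x' = x
  · subst hx
    by_cases hy : y' = y
    · subst hy
      simp only [of_apply_self]
    · simp only [of_apply_target_ne _ hy, smul_zero]
  · simp only [of_apply_source_ne _ hx, smul_zero]

variable [Fintype C]

theorem of_mul_of {x y z : C} (g : y ⟶ z) (f : x ⟶ y) : of g * of f = of (f ≫ g) := by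
  refine CatAlg.ext fun x' z' => ?_
  rw [mul_apply, Finset.sum_eq_single y]
  · by_cases hx : x' = x
    · subst hx
      by_cases hz : z' = z
      · subst hz
        simp only [of_apply_self]
      · simp only [of_apply_target_ne _ hz, Limits.comp_zero]
    · simp only [of_apply_source_ne _ hx, Limits.zero_comp]
  · intro y' _ hy
    rw [of_apply_target_ne _ hy, Limits.zero_comp]
  · simp

theorem of_mul_of_ne {w x y z : C} (g : y ⟶ z) (f : w ⟶ x) (h : x ≠ y) : of g * of f = 0 := by
  refine CatAlg.ext fun x' z' => ?_
  rw [mul_apply, zero_apply]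
  refine Finset.sum_eq_zero fun y' _ => ?_
  by_cases hy : y' = x
  · subst hy
    rw [of_apply_source_ne g h, Limits.comp_zero]
  · rw [of_apply_target_ne f hy, Limits.zero_comp]

theorem sum_apply {ι : Type*} (s : Finset ι) (a : ι → CatAlg C) (x y : C) :
    (∑ i ∈ s, a i) x y = ∑ i ∈ s, a i x y := by
  classical
  induction s using Finset.induction_on with
  | empty => simp [zero_apply]
  | insert i s hi ih => rw [Finset.sum_insert hi, Finset.sum_insert hi, add_apply, ih]

/-- This decomposition is what makes a homomorphism determined by its values on single morphisms. -/
theorem sum_of (a : CatAlg C) : ∑ x, ∑ y, of (a x y) = a := by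
  refine CatAlg.ext fun x y => ?_
  rw [sum_apply, Finset.sum_eq_single x, sum_apply, Finset.sum_eq_single y, of_apply_self]
  · intro z _ hz
    exact of_apply_target_ne _ hz.symm _
  · simp
  · intro z _ hz
    rw [sum_apply]
    exact Finset.sum_eq_zero fun w _ => of_apply_source_ne _ hz.symm _
  · simp

theorem sum_of_id : ∑ x : C, of (𝟙 x) = 1 := by
  refine CatAlg.ext fun x y => ?_
  rw [sum_apply, Finset.sum_eq_single x]
  · by_cases h : y = x
    · subst h
      rw [of_apply_self, one_apply_self]
    · rw [of_apply_target_ne _ h, one_apply_ne h]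
  · intro z _ hz
    exact of_apply_source_ne _ hz.symm _
  · simp

theorem finsum_of_id : ∑ᶠ x : C, of (𝟙 x) = 1 := by
  rw [finsum_eq_sum_of_fintype, sum_of_id]

end Of

section Lift

variable {k : Type*} [Field k] {C : Type*} [Category C] [Preadditive C] [Linear k C] [Fintype C]
  {R : Type*} [Ring R] [Algebra k R]

/-- Linear maps on the morphism spaces that reverse compositions and send the identities to a
complete family of orthogonal idempotents induce a homomorphism on the algebra of the category. -/
def lift (φ : (x y : C) → (x ⟶ y) →ₗ[k] R)
    (hcomp : ∀ (x y z : C) (f : x ⟶ y) (g : y ⟶ z), φ x z (f ≫ g) = φ y z g * φ x y f)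
    (hne : ∀ x y : C, x ≠ y → φ x x (𝟙 x) * φ y y (𝟙 y) = 0)
    (hone : ∑ᶠ x, φ x x (𝟙 x) = 1) : CatAlg C →ₐ[k] R :=
  AlgHom.ofLinearMap
    { toFun := fun a => ∑ x, ∑ y, φ x y (a x y)
      map_add' := fun a b => by simp [add_apply, Finset.sum_add_distrib]
      map_smul' := fun c a => by simp [smul_apply, Finset.smul_sum] }
    (by
      rw [finsum_eq_sum_of_fintype] at hone
      change ∑ x, ∑ y, φ x y ((1 : CatAlg C) x y) = 1
      rw [← hone]
      refine Finset.sum_congr rfl fun x _ => ?_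
      rw [Finset.sum_eq_single x, one_apply_self]
      · intro y _ hy
        rw [one_apply_ne hy, map_zero]
      · exact fun h => absurd (Finset.mem_univ x) h)
    (by
      intro a b
      change ∑ x, ∑ z, φ x z ((a * b) x z) = (∑ y, ∑ z, φ y z (a y z)) * ∑ x, ∑ y, φ x y (b x y)
      -- Inserting the identities at the two unequal middle objects makes the product contain two
      -- orthogonal idempotents.
      have horth : ∀ (x y y' z : C) (g : y' ⟶ z) (f : x ⟶ y), y' ≠ y → φ y' z g * φ x y f = 0 := by
        intro x y y' z g f h
        have h₁ : φ y' z g = φ y' z g * φ y' y' (𝟙 y') := by rw [← hcomp, Category.id_comp]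
        have h₂ : φ x y f = φ y y (𝟙 y) * φ x y f := by rw [← hcomp, Category.comp_id]
        rw [h₁, h₂, mul_assoc, ← mul_assoc (φ y' y' (𝟙 y')), hne _ _ h, zero_mul, mul_zero]
      have hR : (∑ y, ∑ z, φ y z (a y z)) * ∑ x, ∑ y, φ x y (b x y) =
          ∑ x, ∑ y, ∑ z, φ y z (a y z) * φ x y (b x y) := by
        simp only [Finset.sum_mul, Finset.mul_sum]
        refine Finset.sum_congr rfl fun x _ => Finset.sum_congr rfl fun y _ =>
          Finset.sum_eq_single y (fun y' _ h => Finset.sum_eq_zero fun z _ => horth _ _ _ _ _ _ h)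
          (fun h => absurd (Finset.mem_univ y) h)
      rw [hR]
      simp only [mul_apply, map_sum, hcomp]
      exact Finset.sum_congr rfl fun x _ => Finset.sum_comm)

theorem lift_of (φ : (x y : C) → (x ⟶ y) →ₗ[k] R) (hcomp hne hone) {x y : C} (f : x ⟶ y) :
    lift φ hcomp hne hone (of f) = φ x y f := by
  change ∑ x', ∑ y', φ x' y' (of f x' y') = φ x y f
  rw [Finset.sum_eq_single x, Finset.sum_eq_single y, of_apply_self]
  · intro z _ hz
    rw [of_apply_target_ne _ hz, map_zero]
  · simp
  · intro z _ hz
    exact Finset.sum_eq_zero fun w _ => by rw [of_apply_source_ne _ hz, map_zero]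
  · simp

theorem algHom_ext {f g : CatAlg C →ₐ[k] R}
    (h : ∀ (x y : C) (a : x ⟶ y), f (of a) = g (of a)) : f = g := by
  refine AlgHom.ext fun a => ?_
  rw [← sum_of a]
  simp only [map_sum, h]

end Lift

end CatAlg

/-! ### Realizations of quivers in rings, and maps out of path algebras and their quotients -/

section PathCat

variable {k : Type*} [Field k] {Q : Type*} [Quiver Q]

theorem pathHom_nil (x : Q) : pathHom k (Quiver.Path.nil : Quiver.Path x x) = 𝟙 (pathObj k x) :=
  rfl

theorem pathHom_comp {x y z : Q} (p : Quiver.Path x y) (q : Quiver.Path y z) :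
    pathHom k p ≫ pathHom k q = pathHom k (p.comp q) :=
  ((Free.embedding k (Paths Q)).map_comp (X := x) (Y := y) (Z := z) p q).symm

theorem pathHom_cons {x y z : Q} (p : Quiver.Path x y) (a : y ⟶ z) :
    pathHom k (p.cons a) = pathHom k p ≫ pathHom k a.toPath :=
  (pathHom_comp p a.toPath).symm

/-- Every morphism of the path category is a linear combination of paths. -/
theorem pathCat_induction {x y : Q} {motive : (pathObj k x ⟶ pathObj k y) → Prop}
    (path : ∀ p : Quiver.Path x y, motive (pathHom k p))
    (zero : motive 0) (add : ∀ f g, motive f → motive g → motive (f + g))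
    (smul : ∀ (c : k) f, motive f → motive (c • f)) (f) : motive f := by
  refine Finsupp.induction_linear (motive := motive) f zero add fun p c => ?_
  have h : c • pathHom k (p : Quiver.Path x y) = Finsupp.single p c := by
    change c • Finsupp.single p (1 : k) = _
    rw [Finsupp.smul_single, smul_eq_mul, mul_one]
  exact (congrArg motive h).mp (smul c _ (path p))

variable {R : Type*} [Ring R]

/-- A realization of a quiver in a ring: a complete family of orthogonal idempotents indexed by
the vertices, and compatible elements for the arrows. -/
structure QuiverRealization (Q : Type*) [Quiver Q] (R : Type*) [Ring R] where
  vtx : Q → R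
  arr : {x y : Q} → (x ⟶ y) → R
  vtx_mul_self : ∀ x, vtx x * vtx x = vtx x
  vtx_mul_ne : ∀ x y, x ≠ y → vtx x * vtx y = 0
  finsum_vtx : ∑ᶠ x, vtx x = 1
  vtx_mul_arr : ∀ {x y : Q} (a : x ⟶ y), vtx y * arr a = arr a
  arr_mul_vtx : ∀ {x y : Q} (a : x ⟶ y), arr a * vtx x = arr a

namespace QuiverRealization

variable (ρ : QuiverRealization Q R)

/-- The element of the ring given by a path. -/
def path {x : Q} : {y : Q} → Quiver.Path x y → R
  | _, Quiver.Path.nil => ρ.vtx x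
  | _, Quiver.Path.cons p a => ρ.arr a * path p

theorem path_nil (x : Q) : ρ.path (Quiver.Path.nil : Quiver.Path x x) = ρ.vtx x := rfl

theorem path_cons {x y z : Q} (p : Quiver.Path x y) (a : y ⟶ z) :
    ρ.path (p.cons a) = ρ.arr a * ρ.path p := rfl

theorem path_toPath {x y : Q} (a : x ⟶ y) : ρ.path a.toPath = ρ.arr a :=
  ρ.arr_mul_vtx a

theorem vtx_mul_path {x y : Q} (p : Quiver.Path x y) : ρ.vtx y * ρ.path p = ρ.path p := by
  cases p with
  | nil => exact ρ.vtx_mul_self x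
  | cons p a => rw [path_cons, ← mul_assoc, ρ.vtx_mul_arr]

theorem path_comp {x y z : Q} (p : Quiver.Path x y) (q : Quiver.Path y z) :
    ρ.path (p.comp q) = ρ.path q * ρ.path p := by
  induction q with
  | nil => exact (ρ.vtx_mul_path p).symm
  | cons q a ih => rw [Quiver.Path.comp_cons, path_cons, path_cons, ih, mul_assoc]

variable [Algebra k R]

variable (k) in
/-- The linear extension of `path` to the morphisms of the path category. -/
def linear (x y : Q) : (pathObj k x ⟶ pathObj k y) →ₗ[k] R :=
  Finsupp.linearCombination k (fun p : Quiver.Path x y => ρ.path p)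

theorem linear_pathHom {x y : Q} (p : Quiver.Path x y) :
    ρ.linear k x y (pathHom k p) = ρ.path p := by
  change Finsupp.linearCombination k (fun p : Quiver.Path x y => ρ.path p) (Finsupp.single p 1) = _
  rw [Finsupp.linearCombination_single, one_smul]

theorem linear_id (x : Q) : ρ.linear k x x (𝟙 (pathObj k x)) = ρ.vtx x :=
  ρ.linear_pathHom (k := k) (Quiver.Path.nil : Quiver.Path x x)

theorem linear_comp (x y z : Q) (f : pathObj k x ⟶ pathObj k y) (g : pathObj k y ⟶ pathObj k z) :
    ρ.linear k x z (f ≫ g) = ρ.linear k y z g * ρ.linear k x y f := by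
  induction f using pathCat_induction with
  | zero => rw [Limits.zero_comp, map_zero, map_zero, mul_zero]
  | add f f' hf hf' => rw [Preadditive.add_comp, map_add, map_add, hf, hf', mul_add]
  | smul c f hf => rw [Linear.smul_comp, map_smul, map_smul, hf, mul_smul_comm]
  | path p =>
    induction g using pathCat_induction with
    | zero => rw [Limits.comp_zero, map_zero, map_zero, zero_mul]
    | add f f' hf hf' => rw [Preadditive.comp_add, map_add, map_add, hf, hf', add_mul]
    | smul c f hf => rw [Linear.comp_smul, map_smul, map_smul, hf, smul_mul_assoc]
    | path q => rw [pathHom_comp, linear_pathHom, linear_pathHom, linear_pathHom, path_comp]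

variable (k) in
/-- The map `linear`, for objects of the path category. -/
def linearMap (X Y : PathCat k Q) : (X ⟶ Y) →ₗ[k] R := ρ.linear k X Y

variable (k) in
/-- The homomorphism from the path algebra given by a realization of the quiver. -/
def pathAlgHom [Finite Q] : PathAlg k Q →ₐ[k] R :=
  CatAlg.lift (ρ.linearMap k)
    (fun x y z f g => ρ.linear_comp x y z f g)
    (fun x y h => (congrArg₂ (· * ·) (ρ.linear_id x) (ρ.linear_id y)).trans (ρ.vtx_mul_ne _ _ h))
    ((finsum_congr fun x : Q => ρ.linear_id (k := k) x).trans ρ.finsum_vtx)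

theorem pathAlgHom_of [Finite Q] {x y : Q} (p : Quiver.Path x y) :
    ρ.pathAlgHom k (CatAlg.of (pathHom k p)) = ρ.path p := by
  exact (CatAlg.lift_of _ _ _ _ (pathHom k p)).trans (ρ.linear_pathHom p)

end QuiverRealization

section Quot

variable [Algebra k R] (S : (X Y : PathCat k Q) → Set (X ⟶ Y)) (ρ : QuiverRealization Q R)

/-- The kernel is stable under composition on both sides, since composites go to products; it is
therefore enough to test generators of the ideal. -/
theorem QuiverRealization.linear_eq_zero
    (hS : ∀ X Y (f : X ⟶ Y), f ∈ S X Y → ρ.linearMap k X Y f = 0) {X Y : PathCat k Q} {f : X ⟶ Y}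
    (hf : f ∈ idealSpan k S X Y) : ρ.linearMap k X Y f = 0 := by
  have hle : idealSpan k S X Y ≤ LinearMap.ker (ρ.linearMap k X Y) := by
    rw [idealSpan, Submodule.span_le]
    rintro _ ⟨X', Y', a, r, b, hr, rfl⟩
    change ρ.linearMap k X Y (a ≫ r ≫ b) = 0
    exact (ρ.linear_comp X X' Y a _).trans ((congrArg (· * _) ((ρ.linear_comp X' Y' Y r b).trans
      ((congrArg (_ * ·) (hS _ _ _ hr)).trans (mul_zero _)))).trans (zero_mul _))
  exact hle hf

/-- The linear maps induced on the morphisms of a quotient of the path category. -/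
def QuiverRealization.quotLinear (hS : ∀ X Y (f : X ⟶ Y), f ∈ S X Y → ρ.linearMap k X Y f = 0)
    (X Y : QuotCat k S) : (X ⟶ Y) →ₗ[k] R where
  toFun := Quot.lift (ρ.linearMap k X.as Y.as) fun f g h => by
    -- Morphisms of the quotient category are classes for the closure of the relation under
    -- composition; a congruence is its own closure.
    rw [HomRel.compClosure_eq_self] at h
    have := ρ.linear_eq_zero S hS h
    rwa [map_sub, sub_eq_zero] at this
  map_add' := by
    rintro ⟨f⟩ ⟨g⟩
    exact map_add (ρ.linearMap k X.as Y.as) f g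
  map_smul' := by
    rintro c ⟨f⟩
    exact map_smul (ρ.linearMap k X.as Y.as) c f

theorem QuiverRealization.quotLinear_map (hS) {X Y : PathCat k Q} (f : X ⟶ Y) :
    ρ.quotLinear S hS _ _ ((Quotient.functor (idealRel k S)).map f) = ρ.linearMap k X Y f := rfl

/-- The homomorphism from the algebra of a quotient of the path category given by a realization
of the quiver that satisfies the relations. -/
def QuiverRealization.quotAlgHom [Fintype (QuotCat k S)]
    (hS : ∀ X Y (f : X ⟶ Y), f ∈ S X Y → ρ.linearMap k X Y f = 0) :
    CatAlg (QuotCat k S) →ₐ[k] R :=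
  CatAlg.lift (ρ.quotLinear S hS)
    (by
      rintro ⟨x⟩ ⟨y⟩ ⟨z⟩ ⟨f⟩ ⟨g⟩
      exact ρ.linear_comp x y z f g)
    (by
      rintro ⟨x⟩ ⟨y⟩ h
      have h' : x ≠ y := fun h' => h (by rw [h'])
      exact (congrArg₂ (· * ·) (ρ.linear_id x) (ρ.linear_id y)).trans (ρ.vtx_mul_ne _ _ h'))
    (by
      have e : ∀ X : QuotCat k S, ρ.quotLinear S hS X X (𝟙 X) = ρ.vtx X.as :=
        fun X => ρ.linear_id X.as
      rw [finsum_congr e, ← ρ.finsum_vtx]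
      exact finsum_comp_equiv (f := ρ.vtx)
        ⟨fun X : QuotCat k S => (X.as : Q), fun x => ⟨x⟩, fun _ => rfl, fun _ => rfl⟩)

theorem QuiverRealization.quotAlgHom_of [Fintype (QuotCat k S)] (hS) {x y : Q}
    (p : Quiver.Path x y) :
    ρ.quotAlgHom S hS (CatAlg.of ((Quotient.functor (idealRel k S)).map (pathHom k p))) =
      ρ.path p := by
  rw [quotAlgHom, CatAlg.lift_of, quotLinear_map]
  exact ρ.linear_pathHom p

end Quot

section Ext

variable [Algebra k R] {C : Type*} [Category C] [Preadditive C] [Linear k C] [Fintype C]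

/-- Fullness lifts every morphism to a combination of paths. The identity functor gives the case of
path algebras, the projection functor that of quotients. -/
theorem algHom_ext_of_full (T : PathCat k Q ⥤ C) [T.Additive] [T.Linear k] [T.Full]
    (hT : Function.Surjective T.obj) {f g : CatAlg C →ₐ[k] R}
    (hv : ∀ x : Q, f (CatAlg.of (𝟙 (T.obj (pathObj k x)))) =
      g (CatAlg.of (𝟙 (T.obj (pathObj k x)))))
    (ha : ∀ (x y : Q) (a : x ⟶ y), f (CatAlg.of (T.map (pathHom k a.toPath))) =
      g (CatAlg.of (T.map (pathHom k a.toPath)))) : f = g := by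
  refine CatAlg.algHom_ext fun X Y a => ?_
  obtain ⟨(x : Q), rfl⟩ := hT X
  obtain ⟨(y : Q), rfl⟩ := hT Y
  change T.obj (pathObj k x) ⟶ T.obj (pathObj k y) at a
  change f (CatAlg.of (x := T.obj (pathObj k x)) (y := T.obj (pathObj k y)) a) =
    g (CatAlg.of (x := T.obj (pathObj k x)) (y := T.obj (pathObj k y)) a)
  obtain ⟨b, rfl⟩ := T.map_surjective a
  induction b using pathCat_induction with
  | zero => rw [T.map_zero, CatAlg.of_zero, map_zero, map_zero]
  | add b c hb hc => rw [T.map_add, CatAlg.of_add, map_add, map_add, hb, hc]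
  | smul r b hb =>rw [T.map_smul, CatAlg.of_smul, map_smul, map_smul, hb]
  | path p =>
    induction p with
    | nil =>
      have := hv x
      rwa [← T.map_id] at this
    | cons p a ih =>
      rw [pathHom_cons, T.map_comp, ← CatAlg.of_mul_of, map_mul, map_mul, ha _ _ a, ih]

theorem pathAlg_algHom_ext [Finite Q] {f g : PathAlg k Q →ₐ[k] R}
    (hv : ∀ x : Q, f (CatAlg.of (𝟙 (pathObj k x))) = g (CatAlg.of (𝟙 (pathObj k x))))
    (ha : ∀ (x y : Q) (a : x ⟶ y), f (CatAlg.of (pathHom k a.toPath)) =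
      g (CatAlg.of (pathHom k a.toPath))) : f = g :=
  algHom_ext_of_full (𝟭 _) Function.surjective_id hv ha

theorem quotAlg_algHom_ext (S : (X Y : PathCat k Q) → Set (X ⟶ Y)) [Fintype (QuotCat k S)]
    {f g : CatAlg (QuotCat k S) →ₐ[k] R}
    (hv : ∀ x : Q, f (CatAlg.of (𝟙 ((Quotient.functor (idealRel k S)).obj (pathObj k x)))) =
      g (CatAlg.of (𝟙 ((Quotient.functor (idealRel k S)).obj (pathObj k x)))))
    (ha : ∀ (x y : Q) (a : x ⟶ y),
      f (CatAlg.of ((Quotient.functor (idealRel k S)).map (pathHom k a.toPath))) =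
      g (CatAlg.of ((Quotient.functor (idealRel k S)).map (pathHom k a.toPath)))) : f = g :=
  haveI : (Quotient.functor (idealRel k S)).Linear k := Quotient.linear_functor k _ (idealRel_smul S)
  algHom_ext_of_full (Quotient.functor (idealRel k S)) (fun X => ⟨X.as, rfl⟩) hv ha

end Ext

end PathCat

/-! ### Products along the orbit of a permutation -/

section Word

variable {X Y R R' : Type*} [Ring R] [Ring R']

/-- The product `β (σ ^ (n - 1) x) * ⋯ * β (σ x) * β x`. -/
def word (σ : Equiv.Perm X) (β : X → R) (x : X) (n : ℕ) : R :=
  ((List.range n).map fun i => β ((σ ^ i) x)).reverse.prod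

variable (σ : Equiv.Perm X) (β : X → R)

theorem word_zero (x : X) : word σ β x 0 = 1 := rfl

theorem word_succ (x : X) (n : ℕ) : word σ β x (n + 1) = β ((σ ^ n) x) * word σ β x n := by
  simp [word, List.range_succ]

theorem word_one (x : X) : word σ β x 1 = β x := by
  simp [word_succ, word_zero]

theorem word_add (x : X) (m n : ℕ) :
    word σ β x (m + n) = word σ β ((σ ^ m) x) n * word σ β x m := by
  induction n with
  | zero => simp [word_zero]
  | succ n ih =>
    rw [← add_assoc, word_succ, ih, word_succ, mul_assoc, add_comm m n, pow_add,
      Equiv.Perm.mul_apply]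

theorem word_succ' (x : X) (n : ℕ) : word σ β x (n + 1) = word σ β (σ x) n * β x := by
  rw [add_comm, word_add, word_one, pow_one]

theorem word_mul (x : X) {n : ℕ} (h : (σ ^ n) x = x) (m : ℕ) :
    word σ β x (n * m) = word σ β x n ^ m := by
  induction m with
  | zero => simp [word_zero]
  | succ m ih => rw [mul_add, mul_one, add_comm, word_add, h, ih, pow_succ]

theorem word_eq_zero_of_le {x : X} {m n : ℕ} (hmn : m ≤ n) (h : word σ β x m = 0) :
    word σ β x n = 0 := by
  obtain ⟨l, rfl⟩ := Nat.exists_eq_add_of_le hmn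
  rw [word_add, h, mul_zero]

theorem map_word {F : Type*} [FunLike F R R'] [MonoidHomClass F R R'] (f : F) (x : X) (n : ℕ) :
    f (word σ β x n) = word σ (fun y => f (β y)) x n := by
  induction n with
  | zero => rw [word_zero, word_zero, map_one]
  | succ n ih => rw [word_succ, word_succ, map_mul, ih]

theorem word_semiconj (τ : Equiv.Perm Y) (ι : Y → X) (h : ∀ y, ι (τ y) = σ (ι y)) (y : Y) (n : ℕ) :
    word τ (fun z => β (ι z)) y n = word σ β (ι y) n := by
  have hi : ∀ i : ℕ, ι ((τ ^ i) y) = (σ ^ i) (ι y) := by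
    intro i
    induction i with
    | zero => rfl
    | succ i ih => rw [pow_succ', pow_succ', Equiv.Perm.mul_apply, Equiv.Perm.mul_apply, h, ih]
  simp only [word, hi]

/-- Reversing the factors means walking the orbit backwards from its end. The shift by `σ` inside
`β` reflects that the arrow of `e` corresponds to the angle `g e`. -/
theorem word_op (x : X) (n : ℕ) :
    word σ (fun y => MulOpposite.op (β (σ y))) x n =
      MulOpposite.op (word σ⁻¹ β ((σ ^ n) x) n) := by
  induction n with
  | zero => rfl
  | succ n ih =>
    rw [word_succ, ih, word_succ', ← MulOpposite.op_mul, pow_succ', Equiv.Perm.mul_apply,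
      Equiv.Perm.inv_def, Equiv.symm_apply_apply]

theorem isChain_of_prod_ne_zero (l : List X) (h : (l.map β).reverse.prod ≠ 0) :
    l.IsChain fun x y => β y * β x ≠ 0 := by
  induction l with
  | nil => exact List.IsChain.nil
  | cons a l ih =>
    rw [List.map_cons, List.reverse_cons, List.prod_append, List.prod_singleton] at h
    cases l with
    | nil => exact List.IsChain.singleton a
    | cons b l =>
      refine List.isChain_cons_cons.mpr ⟨fun hab => h ?_, ih fun h0 => h ?_⟩
      · rw [List.map_cons, List.reverse_cons, List.prod_append, List.prod_singleton, mul_assoc, hab,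
          mul_zero]
      · rw [h0, zero_mul]

variable {σ β}

/-- After `n` steps the orbit is back at `x`, so the only factor that the quadratic relations allow
on the left is `β x`, and it produces the word of length `n + 1`. -/
theorem mul_word_eq_zero (hβ : ∀ x y, y ≠ σ x → β y * β x = 0) {x : X} {n : ℕ} (hn : 0 < n)
    (hσ : (σ ^ n) x = x) (h : word σ β x (n + 1) = 0) (y : X) : β y * word σ β x n = 0 := by
  by_cases hy : y = x
  · rw [word_succ, hσ] at h
    rw [hy, h]
  · obtain ⟨m, rfl⟩ := Nat.exists_eq_succ_of_ne_zero hn.ne'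
    rw [word_succ, ← mul_assoc, hβ, zero_mul]
    rwa [← Equiv.Perm.mul_apply, ← pow_succ', hσ]

/-- The only factor allowed on the right is that of `σ⁻¹ x`, and it extends the word to one starting
there. -/
theorem word_mul_eq_zero (hβ : ∀ x y, y ≠ σ x → β y * β x = 0) {x : X} {n : ℕ} (hn : 0 < n)
    (h : word σ β (σ⁻¹ x) (n + 1) = 0) (y : X) : word σ β x n * β y = 0 := by
  by_cases hy : x = σ y
  · subst hy
    rwa [Equiv.Perm.inv_def, Equiv.symm_apply_apply, word_succ'] at h
  · obtain ⟨m, rfl⟩ := Nat.exists_eq_succ_of_ne_zero hn.ne'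
    rw [word_succ', mul_assoc, hβ _ _ hy, mul_zero]

end Word

/-! ### Constructions of realizations: images, opposites, functors -/

namespace QuiverRealization

variable {Q : Type*} [Quiver Q] {R R' : Type*} [Ring R] [Ring R']

/-- The image of a realization under a ring homomorphism. -/
def map [Finite Q] (ρ : QuiverRealization Q R) (f : R →+* R') : QuiverRealization Q R' where
  vtx x := f (ρ.vtx x)
  arr a := f (ρ.arr a)
  vtx_mul_self x := by rw [← map_mul, ρ.vtx_mul_self]
  vtx_mul_ne x y h := by rw [← map_mul, ρ.vtx_mul_ne x y h, map_zero]
  finsum_vtx := by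
    rw [← map_one f, ← ρ.finsum_vtx]
    exact (f.toAddMonoidHom.map_finsum (Set.toFinite _)).symm
  vtx_mul_arr a := by rw [← map_mul, ρ.vtx_mul_arr]
  arr_mul_vtx a := by rw [← map_mul, ρ.arr_mul_vtx]

/-- A realization of a quiver `Q'` in the opposite of a ring that contains a realization of `Q`,
where the vertices of the two quivers correspond to each other. -/
def opposite {Q' : Type*} [Quiver Q'] [Finite Q'] (ρ : QuiverRealization Q R) (e : Q' ≃ Q)
    (arr : {x y : Q'} → (x ⟶ y) → R)
    (h₁ : ∀ {x y : Q'} (a : x ⟶ y), arr a * ρ.vtx (e y) = arr a)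
    (h₂ : ∀ {x y : Q'} (a : x ⟶ y), ρ.vtx (e x) * arr a = arr a) :
    QuiverRealization Q' Rᵐᵒᵖ where
  vtx x := MulOpposite.op (ρ.vtx (e x))
  arr a := MulOpposite.op (arr a)
  vtx_mul_self x := by rw [← MulOpposite.op_mul, ρ.vtx_mul_self]
  vtx_mul_ne x y h := by
    rw [← MulOpposite.op_mul, ρ.vtx_mul_ne _ _ (e.injective.ne h.symm), MulOpposite.op_zero]
  finsum_vtx := by
    rw [← MulOpposite.op_one, ← ρ.finsum_vtx, ← finsum_comp_equiv e]
    exact ((MulOpposite.opAddEquiv (α := R)).toAddMonoidHom.map_finsum (Set.toFinite _)).symm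
  vtx_mul_arr a := by rw [← MulOpposite.op_mul, h₁]
  arr_mul_vtx a := by rw [← MulOpposite.op_mul, h₂]

variable {k : Type*} [Field k] {C : Type*} [Category C] [Preadditive C] [Fintype C]

/-- The realization of a quiver in the algebra of a category given by a functor from the path
category that is bijective on objects. -/
def ofFunctor (T : PathCat k Q ⥤ C) (hT : Function.Bijective T.obj) :
    QuiverRealization Q (CatAlg C) where
  vtx x := CatAlg.of (𝟙 (T.obj (pathObj k x)))
  arr a := CatAlg.of (T.map (pathHom k a.toPath))
  vtx_mul_self x := by rw [CatAlg.of_mul_of, Category.id_comp]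
  vtx_mul_ne x y h := CatAlg.of_mul_of_ne _ _ (hT.1.ne (a₁ := pathObj k y) (a₂ := pathObj k x) h.symm)
  finsum_vtx := by
    rw [← CatAlg.finsum_of_id]
    exact finsum_comp_equiv (Equiv.ofBijective T.obj hT) (f := fun X : C => CatAlg.of (𝟙 X))
  vtx_mul_arr a := by rw [CatAlg.of_mul_of, Category.comp_id]
  arr_mul_vtx a := by rw [CatAlg.of_mul_of, Category.id_comp]

theorem ofFunctor_path (T : PathCat k Q ⥤ C) (hT : Function.Bijective T.obj) {x y : Q}
    (p : Quiver.Path x y) : (ofFunctor T hT).path p = CatAlg.of (T.map (pathHom k p)) := by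
  induction p with
  | nil => rw [path_nil, pathHom_nil, T.map_id]; rfl
  | cons p a ih => rw [path_cons, ih, pathHom_cons, T.map_comp, ← CatAlg.of_mul_of]; rfl

end QuiverRealization

/-! ### Relations in the algebra of a fractional Brauer configuration -/

namespace FracBrauerConfig

variable {E : Type*} (B : FracBrauerConfig E) {k : Type*} [Field k] {R : Type*} [Ring R]

theorem arrows_cons {x y z : B.Polygon} (p : Quiver.Path x y) (a : y ⟶ z) :
    B.arrows (p.cons a) = B.arrows p ++ [a.1] := rfl

/-- The idempotent on the right matters for the empty path, whose list of arrows has product `1`. -/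
theorem path_eq_prod (ρ : QuiverRealization B.Polygon R) (γ : Quotient B.L → R)
    (hγ : ∀ {x y : B.Polygon} (a : x ⟶ y), ρ.arr a = γ a.1) {x y : B.Polygon}
    (p : Quiver.Path x y) : ρ.path p = ((B.arrows p).map γ).reverse.prod * ρ.vtx x := by
  induction p with
  | nil => exact (one_mul _).symm
  | cons p a ih =>
    rw [ρ.path_cons, ih, arrows_cons, List.map_append, List.reverse_append, List.prod_append, hγ,
      mul_assoc]
    simp

theorem prod_map_stdList (γ : Quotient B.L → R) (e : E) (n : ℕ) :
    ((B.stdList e n).map γ).reverse.prod = word B.g (fun h => γ (Quotient.mk B.L h)) e n := by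
  rw [stdList, List.map_map]
  rfl

/-- The endpoints enter through equations so that standard paths of different angles can share one
type, as (fR1) requires. -/
theorem exists_path (e : E) (n : ℕ) {x y : B.Polygon} (hx : B.polygon e = x)
    (hy : B.polygon ((B.g ^ n) e) = y) : ∃ p : Quiver.Path x y, B.arrows p = B.stdList e n := by
  subst hx
  induction n generalizing y with
  | zero =>
    subst hy
    exact ⟨Quiver.Path.nil, rfl⟩
  | succ n ih =>
    obtain ⟨p, hp⟩ := ih rfl
    refine ⟨p.cons ⟨Quotient.mk B.L ((B.g ^ n) e), rfl, ?_⟩, ?_⟩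
    · rw [← hy, pow_succ']
      rfl
    · rw [arrows_cons, hp, stdList, stdList, List.range_succ, List.map_append]
      rfl

/-- The relations are satisfied by a realization of the quiver of a configuration of type MS if
they hold for the standard paths. -/
theorem linear_eq_zero_of_isRel [Algebra k R] (hB : B.IsTypeMS)
    (hd : ∀ e, (B.g ^ B.d e) e = e) (ρ : QuiverRealization B.Polygon R) (γ : Quotient B.L → R)
    (hγ : ∀ {x y : B.Polygon} (a : x ⟶ y), ρ.arr a = γ a.1) (δ : E → R)
    (hδ : ∀ e, γ (Quotient.mk B.L e) = δ e)
    (hzero : ∀ e h, h ≠ B.g e → δ h * δ e = 0)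
    (hcycle : ∀ e h, B.P e h → word B.g δ e (B.d e) = word B.g δ h (B.d h))
    (hlong : ∀ e, word B.g δ e (B.d e + 1) = 0)
    (x y : PathCat k B.Polygon) (f : x ⟶ y) (hf : B.IsRel k x y f) :
    ρ.linearMap k x y f = 0 := by
  have hstd : ∀ e n, ((B.stdList e n).map γ).reverse.prod = word B.g δ e n := by
    intro e n
    rw [prod_map_stdList]
    simp only [hδ]
  cases hf with
  | fR1 e h m x y p q he hh hme hmh hm hp hq =>
    refine (map_sub (ρ.linear k x y) _ _).trans ?_
    rw [ρ.linear_pathHom, ρ.linear_pathHom, B.path_eq_prod ρ γ hγ, B.path_eq_prod ρ γ hγ, hp, hq,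
      hstd, hstd, sub_eq_zero]
    rcases Nat.eq_zero_or_pos m with rfl | hm0
    · rw [Nat.sub_zero, Nat.sub_zero, hcycle e h (Quotient.exact (he.trans hh.symm))]
    -- With `L` trivial, the condition at `i = 1` equates the last angles of the two cycles; one
    -- more step of `g` closes both cycles and gives `e = h`.
    · have h₁ := congrArg B.g (hB _ _ (hm 1 le_rfl hm0))
      rw [← Equiv.Perm.mul_apply, ← Equiv.Perm.mul_apply, ← pow_succ', ← pow_succ',
        Nat.sub_add_cancel (B.d_pos e), Nat.sub_add_cancel (B.d_pos h), hd, hd] at h₁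
      rw [h₁]
  | fR2 n e x y p hn hp hI =>
    refine (ρ.linear_pathHom p).trans ?_
    rw [B.path_eq_prod ρ γ hγ, hp]
    by_contra hne
    have hne' : ((List.ofFn e).map δ).reverse.prod ≠ 0 := by
      intro h0
      apply hne
      have : (List.ofFn fun i => Quotient.mk B.L (e i)).map γ = (List.ofFn e).map δ := by
        rw [List.map_ofFn, List.map_ofFn]
        congr 1
        funext i
        exact hδ _
      rw [this, h0, zero_mul]
    have hch := isChain_of_prod_ne_zero δ _ hne'
    -- A nonzero product forces each angle to be the `g`-successor of the preceding one.
    have hstep : ∀ i (hi : i < n), e ⟨i, hi⟩ = (B.g ^ i) (e ⟨0, by omega⟩) := by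
      intro i
      induction i with
      | zero => intro hi; rfl
      | succ i ih =>
        intro hi
        have := (List.isChain_iff_getElem.mp hch) i (by simpa using hi)
        rw [List.getElem_ofFn, List.getElem_ofFn] at this
        by_contra hc
        refine this (hzero _ _ ?_)
        rwa [ih (by omega), ← Equiv.Perm.mul_apply, ← pow_succ']
    -- A path along an orbit has its last angle in all the translated classes, against the emptiness
    -- in (fR2).
    have hmem : (B.g ^ (n - 1)) (e ⟨0, by omega⟩) ∈
        (⋂ i : Fin n, (B.g ^ (n - 1 - (i : ℕ))) '' {a | B.L (e i) a}) := by
      refine Set.mem_iInter.mpr fun i => ⟨e i, B.L.refl _, ?_⟩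
      rw [hstep i i.2, ← Equiv.Perm.mul_apply, ← pow_add, Nat.sub_add_cancel (by omega)]
    rw [hI] at hmem
    exact hmem
  | fR3 e n x y p hn hp =>
    refine (ρ.linear_pathHom p).trans ?_
    rw [B.path_eq_prod ρ γ hγ, hp, hstd, word_eq_zero_of_le _ _ hn (hlong e), zero_mul]

section Realization

variable (k) [Finite E]

/-- The realization of the quiver in the algebra of its category. -/
def realization : QuiverRealization B.Polygon (CatAlg (B.category k)) :=
  QuiverRealization.ofFunctor (k := k)
    (Quotient.functor (idealRel k (fun x y => {f | B.IsRel k x y f})))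
    ⟨fun _ _ h => congrArg Quotient.as h, fun X => ⟨X.as, rfl⟩⟩

/-- The arrow of a class, as an element of the algebra of the category. -/
def classElt (l : Quotient B.L) : CatAlg (B.category k) :=
  (B.realization k).arr (x := B.src l) (y := B.tgt l) ⟨l, rfl, rfl⟩

theorem realization_arr {x y : B.Polygon} (a : x ⟶ y) :
    (B.realization k).arr a = B.classElt k a.1 := by
  obtain ⟨l, rfl, rfl⟩ := a
  rfl

/-- The arrow of an angle, as an element of the algebra of the category. -/
def angleElt (e : E) : CatAlg (B.category k) := B.classElt k (Quotient.mk B.L e)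

theorem angleElt_mul_vtx (e : E) :
    B.angleElt k e * (B.realization k).vtx (B.polygon e) = B.angleElt k e :=
  (B.realization k).arr_mul_vtx _

theorem vtx_mul_angleElt (e : E) :
    (B.realization k).vtx (B.polygon (B.g e)) * B.angleElt k e = B.angleElt k e :=
  (B.realization k).vtx_mul_arr _

theorem realization_path {x y : B.Polygon} (p : Quiver.Path x y) :
    (B.realization k).path p =
      CatAlg.of ((Quotient.functor (idealRel k (fun x y => {f | B.IsRel k x y f}))).map
        (pathHom k p)) :=
  QuiverRealization.ofFunctor_path _ _ p

variable {k} in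
theorem realization_path_eq_zero {x y : B.Polygon} (p : Quiver.Path x y)
    (h : B.IsRel k (pathObj k x) (pathObj k y) (pathHom k p)) : (B.realization k).path p = 0 := by
  rw [realization_path, (Quotient.functor_map_eq_iff _ _ (0 : pathObj k x ⟶ pathObj k y)).mpr,
    Functor.map_zero, CatAlg.of_zero]
  rw [idealRel, sub_zero]
  exact Submodule.subset_span ⟨_, _, 𝟙 _, _, 𝟙 _, h, by simp⟩

variable {k} in
theorem realization_path_eq {x y : B.Polygon} (p q : Quiver.Path x y)
    (h : B.IsRel k (pathObj k x) (pathObj k y) (pathHom k p - pathHom k q)) :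
    (B.realization k).path p = (B.realization k).path q := by
  rw [realization_path, realization_path, (Quotient.functor_map_eq_iff _ _ (pathHom k q)).mpr]
  exact Submodule.subset_span ⟨_, _, 𝟙 _, _, 𝟙 _, h, by simp⟩

theorem word_mul_vtx (e : E) {n : ℕ} (hn : 0 < n) :
    word B.g (B.angleElt k) e n * (B.realization k).vtx (B.polygon e) =
      word B.g (B.angleElt k) e n := by
  obtain ⟨m, rfl⟩ := Nat.exists_eq_succ_of_ne_zero hn.ne'
  rw [word_succ', mul_assoc, angleElt_mul_vtx]

theorem realization_path_eq_word {x y : B.Polygon} (p : Quiver.Path x y) (e : E) {n : ℕ}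
    (hn : 0 < n) (hx : B.polygon e = x) (hp : B.arrows p = B.stdList e n) :
    (B.realization k).path p = word B.g (B.angleElt k) e n := by
  rw [B.path_eq_prod (B.realization k) (B.classElt k) (B.realization_arr k), hp, prod_map_stdList,
    ← hx]
  exact B.word_mul_vtx k e hn

theorem vtx_mul_word (e : E) {n : ℕ} (hn : 0 < n) :
    (B.realization k).vtx (B.polygon ((B.g ^ n) e)) * word B.g (B.angleElt k) e n =
      word B.g (B.angleElt k) e n := by
  obtain ⟨m, rfl⟩ := Nat.exists_eq_succ_of_ne_zero hn.ne'
  rw [word_succ, ← mul_assoc, pow_succ', Equiv.Perm.mul_apply, vtx_mul_angleElt]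

theorem word_angleElt_long (e : E) : word B.g (B.angleElt k) e (B.d e + 1) = 0 := by
  obtain ⟨p, hp⟩ := B.exists_path e (B.d e + 1) rfl rfl
  rw [← B.realization_path_eq_word k p e (Nat.succ_pos _) rfl hp]
  exact B.realization_path_eq_zero p (.fR3 e _ _ _ p (Nat.lt_succ_self _) hp)

/-- This is (fR1) with `m = 0`; `hd` makes both paths closed, hence parallel. -/
theorem word_angleElt_cycle (hd : ∀ e, (B.g ^ B.d e) e = e) {e h : E} (heh : B.P e h) :
    word B.g (B.angleElt k) e (B.d e) = word B.g (B.angleElt k) h (B.d h) := by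
  have he : B.polygon h = B.polygon e := (Quotient.sound heh).symm
  obtain ⟨p, hp⟩ := B.exists_path e (B.d e) rfl (congrArg B.polygon (hd e))
  obtain ⟨q, hq⟩ := B.exists_path h (B.d h) he ((congrArg B.polygon (hd h)).trans he)
  rw [← B.realization_path_eq_word k p e (B.d_pos e) rfl hp,
    ← B.realization_path_eq_word k q h (B.d_pos h) he hq]
  exact B.realization_path_eq p q (.fR1 e h 0 _ _ p q rfl he (Nat.zero_le _) (Nat.zero_le _)
    (fun i h₁ h₂ => absurd (h₁.trans h₂) (by omega)) hp hq)

/-- If the arrows compose, (fR2) with `n = 2` applies, since its intersection is `{g e} ∩ {h}`;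
otherwise the idempotents between them are orthogonal. -/
theorem angleElt_mul_eq_zero (hB : B.IsTypeMS) {e h : E} (hne : h ≠ B.g e) :
    B.angleElt k h * B.angleElt k e = 0 := by
  by_cases hP : B.polygon (B.g e) = B.polygon h
  · let a : B.polygon e ⟶ B.polygon h := ⟨Quotient.mk B.L e, rfl, hP⟩
    let b : B.polygon h ⟶ B.polygon (B.g h) := ⟨Quotient.mk B.L h, rfl, rfl⟩
    have hp := B.realization_path_eq_zero (k := k) (a.toPath.cons b)
      (.fR2 2 ![e, h] _ _ _ one_lt_two rfl ?_)
    · rw [QuiverRealization.path_cons, QuiverRealization.path_toPath, realization_arr,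
        realization_arr] at hp
      exact hp
    · refine Set.eq_empty_iff_forall_notMem.mpr fun x hx => hne ?_
      obtain ⟨y, hy, rfl⟩ := Set.mem_iInter.mp hx 0
      obtain ⟨z, hz, hzy⟩ := Set.mem_iInter.mp hx 1
      have hy' : e = y := hB _ _ hy
      have hz' : h = z := hB _ _ hz
      subst hy' hz'
      simpa using hzy
  · rw [← B.vtx_mul_angleElt k e, ← B.angleElt_mul_vtx k h, mul_assoc,
      ← mul_assoc ((B.realization k).vtx _), (B.realization k).vtx_mul_ne _ _ (Ne.symm hP), zero_mul,
      mul_zero]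

end Realization

end FracBrauerConfig

/-! ### Relations in a Brauer configuration algebra -/

namespace BrauerConfig

variable {V A : Type*} [Finite V] [Finite A] (D : BrauerConfig V A) (k : Type*) [Field k]

/-- The realization of the quiver in the Brauer configuration algebra. -/
def realization : QuiverRealization D.Polygon (D.algebra k) :=
  (QuiverRealization.ofFunctor (𝟭 (PathCat k D.Polygon)) Function.bijective_id).map
    (RingQuot.mkAlgHom k (D.Rel k)).toRingHom

/-- The arrow of an angle, as an element of the Brauer configuration algebra. -/
def angleElt (e : A) : D.algebra k := RingQuot.mkAlgHom k (D.Rel k) (D.arrowElt k e)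

theorem realization_arr {x y : D.Polygon} (a : x ⟶ y) :
    (D.realization k).arr a = D.angleElt k a.1 := by
  obtain ⟨e, rfl, rfl⟩ := a
  rfl

theorem angleElt_mul_vtx (e : A) :
    D.angleElt k e * (D.realization k).vtx (D.polygon e) = D.angleElt k e :=
  (D.realization k).arr_mul_vtx (D.arrow e)

theorem vtx_mul_angleElt (e : A) :
    (D.realization k).vtx (D.polygon (D.next e)) * D.angleElt k e = D.angleElt k e :=
  (D.realization k).vtx_mul_arr (D.arrow e)

theorem angleElt_mul_eq_zero {e h : A} (hne : h ≠ D.next e) :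
    D.angleElt k h * D.angleElt k e = 0 := by
  rw [angleElt, angleElt, ← map_mul, RingQuot.mkAlgHom_rel k (Rel.zero e h hne), map_zero]

/-- The length of the cycles in the first kind of relations. -/
def degree (e : A) : ℕ := Function.minimalPeriod D.next e * D.mult (D.conn e)

theorem minimalPeriod_next_pos (e : A) : 0 < Function.minimalPeriod D.next e :=
  Function.minimalPeriod_pos_of_mem_periodicPts
    (D.next.injective.mem_periodicPts e)

theorem degree_pos (e : A) : 0 < D.degree e :=
  Nat.mul_pos (D.minimalPeriod_next_pos e) (D.mult_pos _)

theorem next_pow_minimalPeriod (e : A) : (D.next ^ Function.minimalPeriod D.next e) e = e := by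
  rw [Equiv.Perm.coe_pow]
  exact Function.iterate_minimalPeriod

theorem next_pow_degree (e : A) : (D.next ^ D.degree e) e = e := by
  rw [Equiv.Perm.coe_pow]
  exact (Function.isPeriodicPt_minimalPeriod D.next e).mul_const _

theorem specialCycle_pow (e : A) :
    D.specialCycle k e ^ D.mult (D.conn e) = word D.next (D.arrowElt k) e (D.degree e) :=
  (word_mul _ _ e (D.next_pow_minimalPeriod e) _).symm

theorem word_angleElt_cycle {e h : A} (heh : D.P e h) :
    word D.next (D.angleElt k) e (D.degree e) = word D.next (D.angleElt k) h (D.degree h) := by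
  have := RingQuot.mkAlgHom_rel k (Rel.cycle (k := k) e h heh)
  rwa [specialCycle_pow, specialCycle_pow, map_word, map_word] at this

/-- The cycle at `e` may be replaced by the cycle at a second angle `h` of the same polygon. The
last arrow of that cycle has successor `h ≠ e`, so a further factor `e` gives zero. -/
theorem word_angleElt_long (e : A) : word D.next (D.angleElt k) e (D.degree e + 1) = 0 := by
  obtain ⟨h, heh, hne⟩ := Set.exists_ne_of_one_lt_ncard (D.two_le_polygon e) e
  rw [word_succ, next_pow_degree, D.word_angleElt_cycle k heh]
  obtain ⟨m, hm⟩ := Nat.exists_eq_succ_of_ne_zero (D.degree_pos h).ne'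
  have hh := D.next_pow_degree h
  rw [hm] at hh ⊢
  rw [word_succ, ← mul_assoc, angleElt_mul_eq_zero, zero_mul]
  rwa [← Equiv.Perm.mul_apply, ← pow_succ', hh, ne_comm]

end BrauerConfig

/-! ### Comparison of the two kinds of configurations and the isomorphism of their algebras -/

/-- A Brauer configuration which is obtained from a fractional Brauer configuration by reversing
the orientation and adding truncated angles to the polygons. -/
structure Comparison {E V A : Type*} [Finite V] [Finite A] (B : FracBrauerConfig E)
    (D : BrauerConfig V A) where
  incl : E → A
  retr : A → E
  retr_incl : ∀ e, retr (incl e) = e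
  P_iff : ∀ a b, D.P a b ↔ B.P (retr a) (retr b)
  next_incl : ∀ e, D.next (incl e) = incl (B.g⁻¹ e)
  next_eq : ∀ a, a ∉ Set.range incl → D.next a = a
  degree_eq : ∀ a, a ∉ Set.range incl → D.degree a = 1
  degree_incl : ∀ e, D.degree (incl e) = B.d e
  isTypeMS : B.IsTypeMS

namespace Comparison

variable {E V A : Type*} [Finite V] [Finite A] {B : FracBrauerConfig E}
  {D : BrauerConfig V A} (c : Comparison B D)

include c

theorem incl_g (e : E) : c.incl (B.g⁻¹ e) = D.next (c.incl e) := (c.next_incl e).symm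

/-- Integrality of the degree is inherited from the Brauer configuration, where the degree is a
multiple of the period. -/
theorem inv_g_pow_d (e : E) : (B.g⁻¹ ^ B.d e) e = e := by
  have h : ∀ n : ℕ, c.incl ((B.g⁻¹ ^ n) e) = (D.next ^ n) (c.incl e) := by
    intro n
    induction n with
    | zero => rfl
    | succ n ih =>
      rw [pow_succ', pow_succ', Equiv.Perm.mul_apply, Equiv.Perm.mul_apply, incl_g, ih]
  have h₁ := h (B.d e)
  rw [← c.degree_incl, D.next_pow_degree, c.degree_incl] at h₁
  rw [← c.retr_incl ((B.g⁻¹ ^ B.d e) e), h₁, c.retr_incl]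

theorem g_pow_d (e : E) : (B.g ^ B.d e) e = e := by
  have h := c.inv_g_pow_d e
  rw [inv_pow, Equiv.Perm.inv_eq_iff_eq] at h
  exact h.symm

/-- The polygons of the two configurations correspond to each other. -/
def polygonEquiv : B.Polygon ≃ D.Polygon where
  toFun := Quotient.map c.incl fun e h heh => by
    change D.P _ _
    rw [c.P_iff, c.retr_incl, c.retr_incl]
    exact heh
  invFun := Quotient.map c.retr fun a b hab => (c.P_iff a b).mp hab
  left_inv := by
    rintro ⟨e⟩
    exact congrArg (Quotient.mk B.P) (c.retr_incl e)
  right_inv := by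
    rintro ⟨a⟩
    refine Quotient.sound ((c.P_iff _ _).mpr ?_)
    rw [c.retr_incl]

theorem polygonEquiv_polygon (e : E) : c.polygonEquiv (B.polygon e) = D.polygon (c.incl e) := rfl

theorem polygonEquiv_symm_polygon (a : A) :
    c.polygonEquiv.symm (D.polygon a) = B.polygon (c.retr a) := rfl

section

variable (k : Type*) [Field k]

theorem word_op_angleElt (e : E) (n : ℕ) :
    word B.g (fun h => MulOpposite.op (D.angleElt k (c.incl (B.g h)))) e n =
      MulOpposite.op (word D.next (D.angleElt k) (c.incl ((B.g ^ n) e)) n) := by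
  rw [word_op B.g (fun h => D.angleElt k (c.incl h)), word_semiconj D.next _ B.g⁻¹ c.incl c.incl_g]

variable [Finite E]

/-- The realization of the quiver of the fractional configuration in the opposite of the Brauer
configuration algebra. -/
def fracRealization : QuiverRealization B.Polygon (D.algebra k)ᵐᵒᵖ :=
  (D.realization k).opposite c.polygonEquiv (fun a => D.angleElt k (c.incl (B.g a.1.out)))
    (by
      rintro x y ⟨l, rfl, rfl⟩
      have h : B.tgt l = B.polygon (B.g l.out) := congrArg B.tgt l.out_eq.symm
      exact (congrArg (fun z => _ * (D.realization k).vtx (c.polygonEquiv z)) h).trans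
        (D.angleElt_mul_vtx k _))
    (by
      rintro x y ⟨l, rfl, rfl⟩
      have h : B.src l = B.polygon l.out := congrArg B.src l.out_eq.symm
      have h' : c.polygonEquiv (B.src l) = D.polygon (D.next (c.incl (B.g l.out))) := by
        rw [h, polygonEquiv_polygon, c.next_incl, Equiv.Perm.inv_def, Equiv.symm_apply_apply]
      exact (congrArg (fun z => (D.realization k).vtx z * _) h').trans
        (D.vtx_mul_angleElt k _))

/-- The homomorphism from the algebra of the category of the fractional configuration to the
opposite of the Brauer configuration algebra. -/
def fracAlgHom : CatAlg (B.category k) →ₐ[k] (D.algebra k)ᵐᵒᵖ :=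
  (c.fracRealization k).quotAlgHom _
    (B.linear_eq_zero_of_isRel c.isTypeMS c.g_pow_d _
      (fun l => MulOpposite.op (D.angleElt k (c.incl (B.g l.out)))) (fun _ => rfl)
      (fun e => MulOpposite.op (D.angleElt k (c.incl (B.g e))))
      (fun e => by rw [c.isTypeMS _ _ (Quotient.mk_out (s := B.L) e)])
      (by
        intro e h hne
        rw [← MulOpposite.op_mul, D.angleElt_mul_eq_zero, MulOpposite.op_zero]
        rw [c.next_incl, Equiv.Perm.inv_def, Equiv.symm_apply_apply]
        exact fun h' => hne (by simpa [c.retr_incl] using congrArg c.retr h'.symm))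
      (by
        intro e h heh
        rw [word_op_angleElt, word_op_angleElt, c.g_pow_d, c.g_pow_d, ← c.degree_incl,
          ← c.degree_incl, D.word_angleElt_cycle]
        rwa [c.P_iff, c.retr_incl, c.retr_incl])
      (by
        intro e
        -- The reversed word starts at another angle of the orbit; its degree is the same.
        have h : B.d e = B.d ((B.g ^ (B.d e + 1)) e) := 
          B.f3 _ _ ⟨(B.d e + 1 : ℕ), by rw [zpow_natCast]⟩
        rw [word_op_angleElt]
        generalize (B.g ^ (B.d e + 1)) e = e' at h ⊢
        rw [h, ← c.degree_incl, D.word_angleElt_long, MulOpposite.op_zero]))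

theorem fracAlgHom_vtx (x : B.Polygon) : c.fracAlgHom k ((B.realization k).vtx x) =
    MulOpposite.op ((D.realization k).vtx (c.polygonEquiv x)) :=
  QuiverRealization.quotAlgHom_of _ _ _ (Quiver.Path.nil : Quiver.Path x x)

theorem fracAlgHom_angleElt (e : E) : c.fracAlgHom k (B.angleElt k e) =
    MulOpposite.op (D.angleElt k (c.incl (B.g e))) := by
  let a : B.polygon e ⟶ B.polygon (B.g e) := ⟨Quotient.mk B.L e, rfl, rfl⟩
  refine (QuiverRealization.quotAlgHom_of _ _ _ a.toPath).trans ?_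
  rw [QuiverRealization.path_toPath]
  change MulOpposite.op (D.angleElt k (c.incl (B.g (Quotient.mk B.L e).out))) = _
  rw [c.isTypeMS _ _ (Quotient.mk_out (s := B.L) e)]

open Classical in
/-- The element of the algebra of the category that corresponds to an angle of the Brauer
configuration. -/
def angleImage (a : A) : CatAlg (B.category k) :=
  if a ∈ Set.range c.incl then B.angleElt k (B.g⁻¹ (c.retr a))
  else word B.g (B.angleElt k) (c.retr a) (B.d (c.retr a))

theorem angleImage_incl (e : E) : c.angleImage k (c.incl e) = B.angleElt k (B.g⁻¹ e) := by
  rw [angleImage, if_pos ⟨e, rfl⟩, c.retr_incl]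

theorem angleImage_of_notMem {a : A} (ha : a ∉ Set.range c.incl) :
    c.angleImage k a = word B.g (B.angleElt k) (c.retr a) (B.d (c.retr a)) := if_neg ha

theorem angleElt_mul_cycle (e h : E) :
    B.angleElt k h * word B.g (B.angleElt k) e (B.d e) = 0 :=
  mul_word_eq_zero (fun _ _ => B.angleElt_mul_eq_zero k c.isTypeMS) (B.d_pos e) (c.g_pow_d e)
    (B.word_angleElt_long k e) h

theorem cycle_mul_angleElt (e h : E) :
    word B.g (B.angleElt k) e (B.d e) * B.angleElt k h = 0 := by
  refine word_mul_eq_zero (fun _ _ => B.angleElt_mul_eq_zero k c.isTypeMS) (B.d_pos e) ?_ h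
  -- (fR3) is needed at the predecessor of `e`, which has the same degree.
  rw [B.f3 e (B.g⁻¹ e) ⟨-1, by simp⟩]
  exact B.word_angleElt_long k _

/-- Only the case of two original angles needs `h`. An added angle is sent to a full cycle, which is
annihilated by every arrow on both sides, so every product involving it is zero. -/
theorem angleImage_mul_eq_zero {a b : A} (h : b ≠ D.next a) :
    c.angleImage k a * c.angleImage k b = 0 := by
  by_cases ha : a ∈ Set.range c.incl
  · obtain ⟨e, rfl⟩ := ha
    rw [angleImage_incl]
    by_cases hb : b ∈ Set.range c.incl
    · obtain ⟨f, rfl⟩ := hb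
      rw [angleImage_incl]
      refine B.angleElt_mul_eq_zero k c.isTypeMS fun h' => h ?_
      rw [c.next_incl, h', Equiv.Perm.inv_def, Equiv.apply_symm_apply]
    · rw [angleImage_of_notMem c k hb, angleElt_mul_cycle c]
  · rw [angleImage_of_notMem c k ha]
    by_cases hb : b ∈ Set.range c.incl
    · obtain ⟨f, rfl⟩ := hb
      rw [angleImage_incl, cycle_mul_angleElt c]
    · rw [angleImage_of_notMem c k hb]
      obtain ⟨m, hm⟩ := Nat.exists_eq_succ_of_ne_zero (B.d_pos (c.retr b)).ne'
      rw [hm, word_succ, ← mul_assoc, cycle_mul_angleElt c, zero_mul]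

/-- Both kinds of angles yield the full cycle at their polygon: an original angle by walking its
orbit backwards, an added one because its word is its single loop. -/
theorem word_angleImage (a : A) :
    word D.next (fun b => MulOpposite.op (c.angleImage k b)) a (D.degree a) =
      MulOpposite.op (word B.g (B.angleElt k) (c.retr a) (B.d (c.retr a))) := by
  by_cases ha : a ∈ Set.range c.incl
  · obtain ⟨e, rfl⟩ := ha
    rw [← word_semiconj D.next _ B.g⁻¹ c.incl c.incl_g]
    simp only [angleImage_incl]
    rw [word_op B.g⁻¹ (B.angleElt k), inv_inv, c.degree_incl, c.inv_g_pow_d, c.retr_incl]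
  · rw [c.degree_eq a ha, word_one, angleImage_of_notMem c k ha]

/-- The realization of the quiver of the Brauer configuration in the opposite of the algebra of
the category of the fractional configuration. -/
def brauerRealization : QuiverRealization D.Polygon (CatAlg (B.category k))ᵐᵒᵖ :=
  (B.realization k).opposite c.polygonEquiv.symm (fun a => c.angleImage k a.1)
    (by
      rintro x y ⟨a, rfl, rfl⟩
      rw [polygonEquiv_symm_polygon]
      by_cases ha : a ∈ Set.range c.incl
      · obtain ⟨e, rfl⟩ := ha
        rw [angleImage_incl, c.next_incl, c.retr_incl, B.angleElt_mul_vtx]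
      · rw [angleImage_of_notMem c k ha, c.next_eq a ha, B.word_mul_vtx k _ (B.d_pos _)])
    (by
      rintro x y ⟨a, rfl, rfl⟩
      rw [polygonEquiv_symm_polygon]
      by_cases ha : a ∈ Set.range c.incl
      · obtain ⟨e, rfl⟩ := ha
        have h := B.vtx_mul_angleElt k (B.g⁻¹ e)
        rw [Equiv.Perm.inv_def, Equiv.apply_symm_apply] at h
        rw [angleImage_incl, c.retr_incl, Equiv.Perm.inv_def, h]
      · have h := B.vtx_mul_word k (c.retr a) (B.d_pos (c.retr a))
        rw [c.g_pow_d] at h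
        rw [angleImage_of_notMem c k ha, h])

theorem pathAlgHom_arrowElt (a : A) : (c.brauerRealization k).pathAlgHom k (D.arrowElt k a) =
    MulOpposite.op (c.angleImage k a) :=
  (QuiverRealization.pathAlgHom_of _ _).trans (QuiverRealization.path_toPath _ _)

theorem pathAlgHom_eq_of_rel ⦃x y : PathAlg k D.Polygon⦄ (h : D.Rel k x y) :
    (c.brauerRealization k).pathAlgHom k x = (c.brauerRealization k).pathAlgHom k y := by
  cases h with
  | cycle a b hab =>
    rw [D.specialCycle_pow, D.specialCycle_pow, map_word, map_word]
    simp only [pathAlgHom_arrowElt]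
    rw [word_angleImage, word_angleImage,
      B.word_angleElt_cycle k c.g_pow_d ((c.P_iff a b).mp hab)]
  | zero a b hne =>
    rw [map_mul, map_zero, pathAlgHom_arrowElt, pathAlgHom_arrowElt, ← MulOpposite.op_mul,
      angleImage_mul_eq_zero c k hne, MulOpposite.op_zero]

/-- The homomorphism from the Brauer configuration algebra to the algebra of the fractional
configuration. -/
def brauerAlgHom : D.algebra k →ₐ[k] B.algebra k :=
  RingQuot.liftAlgHom k ⟨(c.brauerRealization k).pathAlgHom k, c.pathAlgHom_eq_of_rel k⟩

theorem brauerAlgHom_vtx (x : D.Polygon) : c.brauerAlgHom k ((D.realization k).vtx x) =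
    MulOpposite.op ((B.realization k).vtx (c.polygonEquiv.symm x)) :=
  (RingQuot.liftAlgHom_mkAlgHom_apply _ _ _ _).trans
    (QuiverRealization.pathAlgHom_of _ (Quiver.Path.nil : Quiver.Path x x))

theorem brauerAlgHom_angleElt (a : A) : c.brauerAlgHom k (D.angleElt k a) =
    MulOpposite.op (c.angleImage k a) :=
  (RingQuot.liftAlgHom_mkAlgHom_apply _ _ _ _).trans (c.pathAlgHom_arrowElt k a)

/-- For an added angle the full cycle at its polygon is sent to the corresponding cycle of `D`,
which the cycle relation identifies with the loop, the loop being its own full cycle. -/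
theorem fracAlgHom_angleImage (a : A) :
    c.fracAlgHom k (c.angleImage k a) = MulOpposite.op (D.angleElt k a) := by
  by_cases ha : a ∈ Set.range c.incl
  · obtain ⟨e, rfl⟩ := ha
    rw [angleImage_incl, fracAlgHom_angleElt, Equiv.Perm.inv_def, Equiv.apply_symm_apply]
  · rw [angleImage_of_notMem c k ha, map_word]
    simp only [fracAlgHom_angleElt]
    rw [word_op_angleElt, c.g_pow_d, ← c.degree_incl, D.word_angleElt_cycle k (h := a),
      c.degree_eq a ha, word_one]
    rw [c.P_iff, c.retr_incl]

/-- The algebras of the two configurations are isomorphic. -/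
def algEquiv : B.algebra k ≃ₐ[k] D.algebra k :=
  AlgEquiv.ofAlgHom (AlgHom.opComm (c.fracAlgHom k)) (c.brauerAlgHom k)
    (by
      refine RingQuot.ringQuot_ext' k _ _ (pathAlg_algHom_ext (fun x => ?_) fun x y a => ?_)
      · change MulOpposite.unop (c.fracAlgHom k
          (MulOpposite.unop (c.brauerAlgHom k ((D.realization k).vtx x)))) =
            (D.realization k).vtx x
        rw [brauerAlgHom_vtx, MulOpposite.unop_op, fracAlgHom_vtx, MulOpposite.unop_op,
          Equiv.apply_symm_apply]
      · change MulOpposite.unop (c.fracAlgHom k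
          (MulOpposite.unop (c.brauerAlgHom k ((D.realization k).arr a)))) =
            (D.realization k).arr a
        rw [D.realization_arr, brauerAlgHom_angleElt, MulOpposite.unop_op, fracAlgHom_angleImage,
          MulOpposite.unop_op])
    (by
      -- Endomorphisms of the opposite algebra are compared as endomorphisms of the algebra of the
      -- category, where generators are available.
      refine AlgHom.op.symm.injective (quotAlg_algHom_ext _ (fun x => ?_) fun x y a => ?_)
      · change MulOpposite.unop (c.brauerAlgHom k
          (MulOpposite.unop (c.fracAlgHom k ((B.realization k).vtx x)))) =
            (B.realization k).vtx x
        rw [fracAlgHom_vtx, MulOpposite.unop_op, brauerAlgHom_vtx, MulOpposite.unop_op,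
          Equiv.symm_apply_apply]
      · change MulOpposite.unop (c.brauerAlgHom k
          (MulOpposite.unop (c.fracAlgHom k ((B.realization k).arr a)))) =
            (B.realization k).arr a
        obtain ⟨e, he⟩ := Quotient.exists_rep a.1
        have h : (B.realization k).arr a = B.angleElt k e := by
          rw [B.realization_arr, ← he]
          rfl
        rw [h, fracAlgHom_angleElt, MulOpposite.unop_op, brauerAlgHom_angleElt,
          MulOpposite.unop_op, angleImage_incl, Equiv.Perm.inv_def, Equiv.symm_apply_apply])

end

end Comparison

/-! ### Orbits of permutations, and configurations built from permutations -/

section Perm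

variable {X : Type*} (σ : Equiv.Perm X)

theorem minimalPeriod_eq_of_sameCycle {x y : X} (h : σ.SameCycle x y) :
    Function.minimalPeriod σ x = Function.minimalPeriod σ y := by
  obtain ⟨i, rfl⟩ := h
  refine Function.minimalPeriod_eq_minimalPeriod_iff.mpr fun n => ?_
  rw [Function.IsPeriodicPt, Function.IsFixedPt, Function.IsPeriodicPt, Function.IsFixedPt,
    ← Equiv.Perm.coe_pow, ← Equiv.Perm.mul_apply, ((Commute.refl σ).pow_left n |>.zpow_right i).eq,
    Equiv.Perm.mul_apply, EmbeddingLike.apply_eq_iff_eq]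

theorem ncard_sameCycle [Finite X] (x : X) :
    {y | σ.SameCycle x y}.ncard = Function.minimalPeriod σ x := by
  classical
  have := Fintype.ofFinite X
  have h : {y | σ.SameCycle x y} = MulAction.orbit (Subgroup.zpowers σ) x := by
    ext y
    constructor
    · rintro ⟨i, rfl⟩
      exact ⟨⟨σ ^ i, i, rfl⟩, rfl⟩
    · rintro ⟨⟨_, i, rfl⟩, rfl⟩
      exact ⟨i, rfl⟩
  have := Fintype.ofFinite (MulAction.orbit (Subgroup.zpowers σ) x)
  rw [h, Set.ncard_eq_toFinset_card', Set.toFinset_card]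
  exact (MulAction.minimalPeriod_eq_card (a := σ) (b := x)).symm

theorem eq_of_sameCycle [Finite X] {Y : Type*} {f : X → Y} (hf : ∀ x, f (σ x) = f x) {x y : X}
    (h : σ.SameCycle x y) : f x = f y := by
  obtain ⟨n, rfl⟩ := h.exists_nat_pow_eq
  induction n with
  | zero => rfl
  | succ n ih =>
    rw [pow_succ', Equiv.Perm.mul_apply, hf]
    exact ih ⟨n, by rw [zpow_natCast]⟩

end Perm

/-- A fractional Brauer configuration of type MS, given by a permutation whose orbits have integral
fractional degree. -/
def FracBrauerConfig.ofPerm {E : Type*} [Finite E] (g : Equiv.Perm E) (P : Setoid E) (d : E → ℕ)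
    (d_pos : ∀ e, 0 < d e) (hd : ∀ e, (g ^ d e) e = e) (hg : ∀ e h, g.SameCycle e h → d e = d h) :
    FracBrauerConfig E where
  g := g
  P := P
  L := ⊥
  d := d
  d_pos := d_pos
  f1_le := by
    rintro e _ rfl
    exact P.refl e
  f1_finite _ := Set.toFinite _
  f2 := by
    rintro e _ rfl
    exact P.refl _
  f3 := hg
  f4 e h := by rw [hd, hd]
  f5 e h := by rw [hd, hd]
  f6 e h hi := by
    refine hi.eq_of_length ?_
    -- Containment puts `e` on the orbit of `h`, so the degrees and hence the lengths of the lists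
    -- agree, and a contiguous sublist of full length is the whole list.
    have he : Quotient.mk ⊥ e ∈ (List.range (d h)).map fun i => (Quotient.mk ⊥ ((g ^ i) h)) :=
      hi.subset (List.mem_map.mpr ⟨0, List.mem_range.mpr (d_pos e), rfl⟩)
    obtain ⟨i, -, hi⟩ := List.mem_map.mp he
    have hi' : (g ^ i) h = e := Quotient.exact hi
    simp only [List.length_map, List.length_range]
    exact (hg h e ⟨i, by rw [zpow_natCast, hi']⟩).symm

/-- A Brauer configuration given by a permutation and the lengths of the cycles in the relations. -/
def BrauerConfig.ofDegree {A : Type*} [Finite A] (next : Equiv.Perm A) (P : Setoid A) (d : A → ℕ)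
    (d_pos : ∀ a, 0 < d a) (hd : ∀ a, Function.minimalPeriod next a ∣ d a)
    (hnext : ∀ a, d (next a) = d a) (two_le : ∀ a, ∃ b, P a b ∧ b ≠ a)
    (one_lt : ∀ a, ∃ b, P a b ∧ 1 < d b) :
    BrauerConfig (Quotient (Equiv.Perm.SameCycle.setoid next)) A where
  conn := Quotient.mk _
  conn_surjective := Quotient.mk_surjective
  P := P
  two_le_polygon a := by
    obtain ⟨b, hb, hne⟩ := two_le a
    exact (Set.one_lt_ncard (Set.toFinite _)).mpr ⟨a, P.refl a, b, hb, hne.symm⟩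
  next := next
  conn_eq_iff _ _ := Quotient.eq
  -- Period times multiplicity must recover `d`; the choice of representative is harmless because
  -- both numbers are constant on cycles.
  mult v := d v.out / Function.minimalPeriod next v.out
  mult_pos v := Nat.div_pos (Nat.le_of_dvd (d_pos _) (hd _))
    (Function.minimalPeriod_pos_of_mem_periodicPts (next.injective.mem_periodicPts _))
  exists_not_truncated a := by
    obtain ⟨b, hb, hlt⟩ := one_lt a
    refine ⟨b, hb, ?_⟩
    have h : next.SameCycle b (Quotient.mk (Equiv.Perm.SameCycle.setoid next) b).out :=
      (Quotient.mk_out (s := Equiv.Perm.SameCycle.setoid next) b).symm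
    have hs : {a | Quotient.mk (Equiv.Perm.SameCycle.setoid next) a = Quotient.mk _ b} =
        {a | next.SameCycle b a} := by
      ext a
      exact Quotient.eq.trans ⟨fun h => h.symm, fun h => h.symm⟩
    rw [hs, ncard_sameCycle, minimalPeriod_eq_of_sameCycle next h, Nat.mul_div_cancel' (hd _),
      ← eq_of_sameCycle next hnext h]
    exact hlt

theorem BrauerConfig.degree_ofDegree {A : Type*} [Finite A] (next : Equiv.Perm A) (P : Setoid A)
    (d : A → ℕ) (d_pos hd hnext two_le one_lt) (a : A) :
    (BrauerConfig.ofDegree next P d d_pos hd hnext two_le one_lt).degree a = d a := by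
  have h : next.SameCycle a (Quotient.mk (Equiv.Perm.SameCycle.setoid next) a).out :=
    (Quotient.mk_out (s := Equiv.Perm.SameCycle.setoid next) a).symm
  change Function.minimalPeriod next a * (d (Quotient.mk (Equiv.Perm.SameCycle.setoid next) a).out /
    Function.minimalPeriod next (Quotient.mk (Equiv.Perm.SameCycle.setoid next) a).out) = d a
  rw [← minimalPeriod_eq_of_sameCycle next h, ← eq_of_sameCycle next hnext h,
    Nat.mul_div_cancel' (hd a)]

/-! ### From Brauer configurations to fractional ones -/

namespace BrauerConfig

variable {V A : Type*} [Finite V] [Finite A] (D : BrauerConfig V A)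

theorem degree_eq_of_sameCycle {a b : A} (h : D.next.SameCycle a b) : D.degree a = D.degree b := by
  rw [degree, degree, minimalPeriod_eq_of_sameCycle _ h, (D.conn_eq_iff a b).mpr h]

/-- The fractional Brauer configuration of a Brauer configuration. -/
def toFrac : FracBrauerConfig A :=
  FracBrauerConfig.ofPerm D.next⁻¹ D.P D.degree D.degree_pos
    (fun a => by rw [inv_pow, Equiv.Perm.inv_eq_iff_eq, D.next_pow_degree])
    fun _ _ h => D.degree_eq_of_sameCycle (Equiv.Perm.sameCycle_inv.mp h)

theorem toFrac_isTypeMS : D.toFrac.IsTypeMS := fun _ _ h => h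

theorem toFrac_hasIntegralFDegree : D.toFrac.HasIntegralFDegree := by
  refine fun a => ⟨Set.toFinite _, D.mult (D.conn a), ?_⟩
  have h : D.toFrac.vertex a = {b | D.next.SameCycle a b} :=
    Set.ext fun b => Equiv.Perm.sameCycle_inv
  have h0 : (Function.minimalPeriod D.next a : ℚ) ≠ 0 :=
    Nat.cast_ne_zero.mpr (D.minimalPeriod_next_pos a).ne'
  rw [FracBrauerConfig.fDegree, h, ncard_sameCycle]
  change ((D.degree a : ℕ) : ℚ) / _ = _
  rw [degree, Nat.cast_mul, mul_div_cancel_left₀ _ h0, Int.cast_natCast]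

/-- The size of a vertex is the period of its angles, so its product with the multiplicity is the
degree. -/
theorem toFrac_exists_one_lt_d (a : A) : ∃ b, D.toFrac.P a b ∧ 1 < D.toFrac.d b := by
  obtain ⟨b, hab, hb⟩ := D.exists_not_truncated a
  refine ⟨b, hab, ?_⟩
  have h : {c | D.conn c = D.conn b} = {c | D.next.SameCycle b c} :=
    Set.ext fun c => eq_comm.trans (D.conn_eq_iff b c)
  rwa [h, ncard_sameCycle] at hb

/-- A Brauer configuration compared with its fractional Brauer configuration. -/
def toFracComparison : Comparison D.toFrac D where
  incl := id
  retr := id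
  retr_incl _ := rfl
  P_iff _ _ := Iff.rfl
  next_incl _ := rfl
  next_eq a h := absurd ⟨a, rfl⟩ h
  degree_eq a h := absurd ⟨a, rfl⟩ h
  degree_incl _ := rfl
  isTypeMS := D.toFrac_isTypeMS

end BrauerConfig

/-! ### From fractional configurations to Brauer configurations, adding truncated angles -/

namespace FracBrauerConfig

variable {E : Type*} (B : FracBrauerConfig E)

/-- The angles of a fractional Brauer configuration, together with a truncated angle for each
polygon with only one angle. -/
abbrev ExtendedAngle : Type _ := E ⊕ {e : E // ∀ h, B.P e h → h = e}

/-- The angle of the fractional configuration in the polygon of an angle. -/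
def baseAngle : B.ExtendedAngle → E := Sum.elim id Subtype.val

/-- The reversed orientation, which fixes the additional angles. -/
def extendedNext : Equiv.Perm B.ExtendedAngle := Equiv.Perm.sumCongr B.g⁻¹ 1

/-- The degree function, extended by one to the additional angles. -/
def extendedDegree : B.ExtendedAngle → ℕ := Sum.elim B.d fun _ => 1

theorem minimalPeriod_extendedNext_inl (e : E) :
    Function.minimalPeriod B.extendedNext (Sum.inl e) = Function.minimalPeriod B.g e := by
  refine Function.minimalPeriod_eq_minimalPeriod_iff.mpr fun n => ?_
  have h : B.extendedNext^[n] (Sum.inl e) = Sum.inl ((B.g⁻¹ ^ n) e) := by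
    induction n with
    | zero => rfl
    | succ n ih => rw [Function.iterate_succ_apply', ih, pow_succ', Equiv.Perm.mul_apply]; rfl
  rw [Function.IsPeriodicPt, Function.IsFixedPt, Function.IsPeriodicPt, Function.IsFixedPt, h,
    Sum.inl.injEq, inv_pow, Equiv.Perm.inv_eq_iff_eq, ← Equiv.Perm.coe_pow, eq_comm]

variable {B} in
-- The number of elements of an orbit is the period, so an integral quotient means divisibility.
theorem HasIntegralFDegree.minimalPeriod_dvd [Finite E] (hB : B.HasIntegralFDegree) (e : E) :
    Function.minimalPeriod B.g e ∣ B.d e := by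
  obtain ⟨-, m, hm⟩ := hB e
  have h0 : (Function.minimalPeriod B.g e : ℚ) ≠ 0 := Nat.cast_ne_zero.mpr
    (Function.minimalPeriod_pos_of_mem_periodicPts (B.g.injective.mem_periodicPts _)).ne'
  rw [fDegree, vertex, ncard_sameCycle, div_eq_iff h0] at hm
  refine Int.natCast_dvd_natCast.mp ⟨m, ?_⟩
  rw [mul_comm]
  exact_mod_cast hm

/-- The Brauer configuration of a fractional Brauer configuration of type MS with integral
fractional degree. -/
def toBrauer [Finite E] (hB : B.HasIntegralFDegree) (hd : ∀ e, ∃ h, B.P e h ∧ 1 < B.d h) :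
    BrauerConfig (Quotient (Equiv.Perm.SameCycle.setoid B.extendedNext)) B.ExtendedAngle :=
  BrauerConfig.ofDegree B.extendedNext (B.P.comap B.baseAngle) B.extendedDegree
    (by
      rintro (e | e)
      · exact B.d_pos e
      · exact one_pos)
    (by
      rintro (e | e)
      · rw [minimalPeriod_extendedNext_inl]
        exact hB.minimalPeriod_dvd e
      · have h : Function.IsFixedPt B.extendedNext (Sum.inr e) := rfl
        rw [Function.minimalPeriod_eq_one_iff_isFixedPt.mpr h]
        exact one_dvd _)
    (by
      rintro (e | e)
      · exact B.f3 _ _ ⟨1, by simp [Equiv.Perm.inv_def]⟩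
      · rfl)
    (by
      rintro (e | e)
      · by_cases he : ∀ h, B.P e h → h = e
        -- A one-angle polygon gets its required second angle from the extension.
        · exact ⟨Sum.inr ⟨e, he⟩, B.P.refl e, Sum.inr_ne_inl⟩
        · push Not at he
          obtain ⟨h, heh, hne⟩ := he
          exact ⟨Sum.inl h, heh, Sum.inl_injective.ne hne⟩
      · exact ⟨Sum.inl e, B.P.refl _, Sum.inl_ne_inr⟩)
    (fun a => by
      obtain ⟨h, hah, hlt⟩ := hd (B.baseAngle a)
      exact ⟨Sum.inl h, hah, hlt⟩)

/-- A fractional Brauer configuration compared with its Brauer configuration. -/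
def toBrauerComparison [Finite E] (hMS : B.IsTypeMS) (hB : B.HasIntegralFDegree)
    (hd : ∀ e, ∃ h, B.P e h ∧ 1 < B.d h) : Comparison B (B.toBrauer hB hd) where
  incl := Sum.inl
  retr := B.baseAngle
  retr_incl _ := rfl
  P_iff _ _ := Iff.rfl
  next_incl _ := rfl
  next_eq := by
    rintro (e | e) h
    · exact absurd ⟨e, rfl⟩ h
    · rfl
  degree_eq := by
    rintro (e | e) h
    · exact absurd ⟨e, rfl⟩ h
    · exact BrauerConfig.degree_ofDegree _ _ _ _ _ _ _ _ _
  degree_incl e := BrauerConfig.degree_ofDegree _ _ _ _ _ _ _ _ _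
  isTypeMS := hMS

end FracBrauerConfig

end FracBrauer

end

theorem mainTheorem8 (k : Type v) [Field k] [IsAlgClosed k] :
    (∀ (E : Type u) [Finite E] (B : FracBrauer.FracBrauerConfig E),
      B.IsTypeMS → B.HasIntegralFDegree → (∀ e : E, ∃ h : E, B.P e h ∧ 1 < B.d h) →
      ∃ (V A : Type u) (_ : Finite V) (_ : Finite A) (D : FracBrauer.BrauerConfig V A),
        Nonempty (B.algebra k ≃ₐ[k] D.algebra k)) ∧
    (∀ (V A : Type u) [Finite V] [Finite A] (D : FracBrauer.BrauerConfig V A),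
      ∃ (E : Type u) (_ : Finite E) (B : FracBrauer.FracBrauerConfig E),
        B.IsTypeMS ∧ B.HasIntegralFDegree ∧ (∀ e : E, ∃ h : E, B.P e h ∧ 1 < B.d h) ∧
        Nonempty (D.algebra k ≃ₐ[k] B.algebra k)) := by
  refine ⟨?_, ?_⟩
  · intro E _ B hMS hB hd
    exact ⟨_, _, inferInstance, inferInstance, B.toBrauer hB hd,
      ⟨(B.toBrauerComparison hMS hB hd).algEquiv k⟩⟩
  · intro V A _ _ D
    exact ⟨A, inferInstance, D.toFrac, D.toFrac_isTypeMS, D.toFrac_hasIntegralFDegree,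
      D.toFrac_exists_one_lt_d, ⟨(D.toFracComparison.algEquiv k).symm⟩⟩
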